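/- \textbf{Theorem (Cardinality classification of a component).} Let $\mathbb{X}$ be a unimodular, locally compact, second countable Hausdorff topological group, and let $(\Omega,\mathcal{A},\mathbf{P})$ be a probability space with a $\mathbf{P}$-preserving left action $(x,\omega)\mapsto\theta_x\omega$ of $\mathbb{X}$ on $\Omega$ that is jointly measurable. Let $\mathfrak{m}$ be a simple point process on $\mathbb{X}$, i.e. a random locally finite counting measure whose atoms all have mass $1$, identified with its set of atoms. Assume that $\mathfrak{m}$ is flow-adapted, i.e. $\mathfrak{m}(\theta_x\omega,B)=\mathfrak{m}(\omega,x^{-1}B)$ for all $x\in\mathbb{X}$, $\omega\in\Omega$ and Borel $B\subseteq\mathbb{X}$, and has finite nonzero intensity, i.e. the measure $B\mapsto\mathbf{E}[\mathfrak{m}(B)]$ is locally finite and not zero. Let $H:\Omega\times\mathbb{X}\to\mathbb{X}$ be a flow-adapted point-shift on $\mathfrak{m}$, i.e. a measurable map such that $H(\theta_y\omega,yx)=yH(\omega,x)$ for all $\omega\in\Omega$ and $x,y\in\mathbb{X}$, and such that for $\mathbf{P}$-a.e. $\omega$ one has $H(\omega,X)\in\mathfrak{m}(\omega)$ for all $X\in\mathfrak{m}(\omega)$.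 We write $H(X)$ for $H(\omega,X)$ and $H^n$ for the $n$-th iterate. Let $G^H$ be the random directed graph with vertex set $\mathfrak{m}$ and an edge from each $X\in\mathfrak{m}$ to $H(X)$; its components are its undirected connected components, and its cycles are its directed cycles (a loop being a cycle of length $1$). A \emph{foil} is an equivalence class of the relation on $\mathfrak{m}$ under which $X\sim Y$ if and only if $H^n(X)=H^n(Y)$ for some $n\ge 0$. A foil $L$ has a \emph{junior foil} if there is $Y\in\mathfrak{m}$ with $H(Y)\in L$; the junior foil is then the foil of $Y$. A point is \emph{primeval} if it lies in $H^n(\mathfrak{m})$ for all $n\ge 0$, and $H^\infty(\mathfrak{m})$ is the set of primeval points. Then $\mathbf{P}$-almost surely each component $C$ of $G^H$ is in one of the following three classes. \begin{enumerate} \item \textbf{Class $\mathcal{F}/\mathcal{F}$:} $C$ is finite, and hence so is each of its foils. In this case, if $n$ is the number of foils of $C$, then $1\le n<\infty$, $C$ has a unique cycle, this cycle has length $n$, and $H^\infty(\mathfrak{m})\cap C$ is the set of vertices of this cycle. \item \textbf{Class $\mathcal{I}/\mathcal{F}$:} $C$ is infinite and each of its foils is finite. In this case $C$ is acyclic, each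 foil of $C$ has a junior foil, and $H^\infty(\mathfrak{m})\cap C$ is the set of points $\{X_n\}_{n\in\mathbb{Z}}$ of a bi-infinite path in $C$, i.e. a sequence of points of $C$ with $H(X_n)=X_{n+1}$ for all $n\in\mathbb{Z}$; this is the only bi-infinite path in $C$, up to a shift of the index. \item \textbf{Class $\mathcal{I}/\mathcal{I}$:} $C$ is infinite and all its foils are infinite. In this case $C$ is acyclic and $H^\infty(\mathfrak{m})\cap C=\emptyset$. \end{enumerate} -/

import Mathlib

open MeasureTheory
open scoped ENNReal Pointwise

/-- A locally compact group is unimodular if its modular function is identically `1`. -/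
def IsUnimodularGroup (X : Type*) [Group X] [TopologicalSpace X] [IsTopologicalGroup X]
    [LocallyCompactSpace X] : Prop :=
  ∀ x : X, Measure.modularCharacter x = 1

section PointProcesses

variable {X Ω : Type*} [MeasurableSpace X] [MeasurableSpace Ω]

/-- A simple point process on `X`: a random locally finite counting measure all of whose atoms have
mass `1`. The measurable structure on `Measure X` is the cylindrical `σ`-algebra, generated by the
evaluations at the measurable subsets of `X`. -/
structure IsSimplePointProcess [TopologicalSpace X] (m : Ω → Measure X) : Prop where
  measurable : Measurable m
  locallyFinite : ∀ ω, IsLocallyFiniteMeasure (m ω)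
  counting : ∀ ω, ∀ B : Set X, MeasurableSet B → ∃ n : ℕ∞, m ω B = (n : ℝ≥0∞)
  simple : ∀ ω, ∀ x : X, m ω {x} ≠ 0 → m ω {x} = 1

/-- The set of points (atoms) of a measure, with which a simple counting measure is identified. -/
def pointsOf (μ : Measure X) : Set X := {x | μ {x} ≠ 0}

/-- The intensity measure `B ↦ 𝐄[m(B)]` of a random measure. -/
noncomputable def intensityMeasure (P : Measure Ω) (m : Ω → Measure X) : Measure X := P.bind m

theorem intensityMeasure_apply {P : Measure Ω} {m : Ω → Measure X} (hm : Measurable m)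
    {B : Set X} (hB : MeasurableSet B) : intensityMeasure P m B = ∫⁻ ω, m ω B ∂P :=
  Measure.bind_apply hB hm.aemeasurable

/-- A point process has intensity in `(0, ∞)` if its intensity measure is locally finite and is not
the zero measure. -/
def HasFiniteNonzeroIntensity [TopologicalSpace X] (P : Measure Ω) (m : Ω → Measure X) : Prop :=
  IsLocallyFiniteMeasure (intensityMeasure P m) ∧ intensityMeasure P m ≠ 0

/-- A random measure is flow-adapted if `m(θ_x ω, B) = m(ω, x⁻¹ B)`, the flow `θ` being the
action of `X` on `Ω`. -/
def IsFlowAdapted [Group X] [MulAction X Ω] (m : Ω → Measure X) : Prop :=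
  ∀ (x : X) (ω : Ω) (B : Set X), MeasurableSet B → m (x • ω) B = m ω (x⁻¹ • B)

/-- A flow-adapted point-shift on the point process `m`. -/
structure IsFlowAdaptedPointShift [Group X] [MulAction X Ω] (P : Measure Ω) (m : Ω → Measure X)
    (H : Ω → X → X) : Prop where
  measurable : Measurable (fun p : Ω × X => H p.1 p.2)
  mapsTo : ∀ᵐ ω ∂P, ∀ x ∈ pointsOf (m ω), H ω x ∈ pointsOf (m ω)
  flowAdapted : ∀ (ω : Ω) (x y : X), H (y • ω) (y * x) = y * H ω x

end PointProcesses

section Graphs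

variable {α : Type*}

/-- The directed graph with vertex set `S` and an edge from each `x ∈ S` to `f x`. -/
def functionalGraph (S : Set α) (f : α → α) : Digraph S where
  Adj x y := f x = y

/-- The undirected connected components of `functionalGraph S f`. -/
abbrev FunctionalComponent (S : Set α) (f : α → α) : Type _ :=
  (functionalGraph S f).toSimpleGraphInclusive.ConnectedComponent

/-- The primeval points: those in the image `f^n(S)` for every `n`. -/
def primevalPoints (S : Set α) (f : α → α) : Set S :=
  {y | ∀ n : ℕ, ∃ x : S, f^[n] x = y}

/-- The foil of `x`: the points `y` of `S` with `f^n(x) = f^n(y)` for some `n`. -/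
def foil (S : Set α) (f : α → α) (x : S) : Set S :=
  {y | ∃ n : ℕ, f^[n] x = f^[n] y}

/-- The set of foils contained in `C`. -/
def foilsIn (S : Set α) (f : α → α) (C : Set S) : Set (Set S) :=
  {L | (∃ x : S, L = foil S f x) ∧ L ⊆ C}

/-- `L'` is the junior foil `L₋` of `L`: it is the foil of some `y` whose image lies in `L`. -/
def IsJuniorFoil (S : Set α) (f : α → α) (L' L : Set S) : Prop :=
  ∃ y z : S, (functionalGraph S f).Adj y z ∧ z ∈ L ∧ L' = foil S f y

/-- A directed cycle of a digraph all of whose vertices lie in `C`. It is a nonempty list of distinct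
vertices up to rotation, with an edge from each vertex to the cyclically next one; a loop at a
vertex is a cycle of length `1`. -/
def IsDirectedCycleIn {V : Type*} (G : Digraph V) (C : Set V) (c : Cycle V) : Prop :=
  c ≠ Cycle.nil ∧ c.Nodup ∧ c.Chain G.Adj ∧ ∀ x ∈ c, x ∈ C

/-- `C` contains no directed cycle (of any length `≥ 1`). -/
def IsAcyclicIn {V : Type*} (G : Digraph V) (C : Set V) : Prop :=
  ∀ c : Cycle V, ¬ IsDirectedCycleIn G C c

/-- A bi-infinite path in `C`. -/
def IsBiInfinitePathIn {V : Type*} (G : Digraph V) (C : Set V) (p : ℤ → V) : Prop :=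
  ∀ n : ℤ, p n ∈ C ∧ G.Adj (p n) (p (n + 1))

/-- Class `F/F`: the component is finite. -/
def IsClassFF (S : Set α) (f : α → α) (C : FunctionalComponent S f) : Prop :=
  C.supp.Finite

/-- Class `I/F`: the component is infinite and each of its foils is finite. -/
def IsClassIF (S : Set α) (f : α → α) (C : FunctionalComponent S f) : Prop :=
  C.supp.Infinite ∧ ∀ L ∈ foilsIn S f C.supp, L.Finite

/-- Class `I/I`: the component is infinite and all its foils are infinite. -/
def IsClassII (S : Set α) (f : α → α) (C : FunctionalComponent S f) : Prop :=
  C.supp.Infinite ∧ ∀ L ∈ foilsIn S f C.supp, L.Infinite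

/-- The structure of a component of class `F/F`: its foils are finite and finite in number, and if
`n ≥ 1` is their number, the component has a unique cycle, which has length `n` and whose vertices
are exactly the primeval points of the component. -/
def StructureFF (S : Set α) (f : α → α) (C : FunctionalComponent S f) : Prop :=
  (∀ L ∈ foilsIn S f C.supp, L.Finite) ∧
  (foilsIn S f C.supp).Finite ∧
  1 ≤ (foilsIn S f C.supp).ncard ∧
  ∃ c : Cycle S,
    IsDirectedCycleIn (functionalGraph S f) C.supp c ∧
    (∀ c' : Cycle S, IsDirectedCycleIn (functionalGraph S f) C.supp c' → c' = c) ∧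
    c.length = (foilsIn S f C.supp).ncard ∧
    primevalPoints S f ∩ C.supp = {x | x ∈ c}

/-- The structure of a component of class `I/F`: it is acyclic, each of its foils has a junior foil,
and its primeval points form a bi-infinite path, which is its only bi-infinite path up to
a shift of the index. -/
def StructureIF (S : Set α) (f : α → α) (C : FunctionalComponent S f) : Prop :=
  IsAcyclicIn (functionalGraph S f) C.supp ∧
  (∀ L ∈ foilsIn S f C.supp, ∃ L' ∈ foilsIn S f C.supp, IsJuniorFoil S f L' L) ∧
  ∃ p : ℤ → S,
    IsBiInfinitePathIn (functionalGraph S f) C.supp p ∧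
    primevalPoints S f ∩ C.supp = Set.range p ∧
    ∀ q : ℤ → S, IsBiInfinitePathIn (functionalGraph S f) C.supp q →
      ∃ k : ℤ, ∀ n : ℤ, q n = p (n + k)

/-- The structure of a component of class `I/I`: it is acyclic and has no primeval point. -/
def StructureII (S : Set α) (f : α → α) (C : FunctionalComponent S f) : Prop :=
  IsAcyclicIn (functionalGraph S f) C.supp ∧
  primevalPoints S f ∩ C.supp = ∅

end Graphs

/-!
On a unimodular group an invariant mass transport sends as much mass out of the points of a
stationary point process as it brings in, in the mean. Hence if each point sends out a bounded mass,
then almost surely no point receives an infinite mass. Letting each point spread a unit mass over a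
finite subset of its class that depends equivariantly on the class shows that infinite components
and infinite foils have no distinguished nonempty finite subset, such as a cycle, the last or the
youngest finite foil, or the primeval points of the foil. Letting each point send a unit mass to its
image shows that the point-shift has finite fibers; letting only the primeval points do so, and
using that a primeval point with finite fiber has a primeval preimage, shows that it is injective on
them. The classification then holds for every self-map with these properties: in an infinite
component with a finite foil, the absence of a last finite foil and of a youngest one leaves only
finite foils, each with a junior foil, and compactness along the finite foils yields exactly one
primeval point in each.
-/

section Dynamics

open Function

variable {α : Type*} {g : α → α} {x y : α}

/-- The relation of lying in the same component of the graph of a self-map, i.e. of having forward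
orbits that meet. -/
def SameComponent (g : α → α) (x y : α) : Prop := ∃ n k : ℕ, g^[n] x = g^[k] y

/-- The relation of lying in the same foil of a self-map, i.e. of having forward orbits that meet
after the same number of steps. -/
def SameFoil (g : α → α) (x y : α) : Prop := ∃ n : ℕ, g^[n] x = g^[n] y

/-- The primeval points of a self-map: those in the range of every iterate. -/
def primevalPts (g : α → α) : Set α := {y | ∀ n : ℕ, ∃ x, g^[n] x = y}

/-- The foils contained in the component of `x`. -/
def foilsOf (g : α → α) (x : α) : Set (Set α) :=
  {L | ∃ y, SameComponent g x y ∧ L = {z | SameFoil g y z}}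

/-- The functional digraph of a self-map. -/
def mapGraph (g : α → α) : Digraph α where
  Adj x y := g x = y

theorem setOf_rel_eq {r : α → α → Prop} (hr : Equivalence r) (h : r x y) :
    {z | r x z} = {z | r y z} :=
  Set.ext fun _ => ⟨hr.trans (hr.symm h), hr.trans h⟩

theorem equivalence_sameComponent (g : α → α) : Equivalence (SameComponent g) where
  refl _ := ⟨0, 0, rfl⟩
  symm := fun ⟨n, k, h⟩ => ⟨k, n, h.symm⟩
  trans := fun ⟨n, k, h⟩ ⟨a, b, h'⟩ => ⟨a + n, k + b, by
    rw [iterate_add_apply, h, ← iterate_add_apply, add_comm a k, iterate_add_apply, h',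
      ← iterate_add_apply]⟩

theorem equivalence_sameFoil (g : α → α) : Equivalence (SameFoil g) where
  refl _ := ⟨0, rfl⟩
  symm := fun ⟨n, h⟩ => ⟨n, h.symm⟩
  trans := fun ⟨n, h⟩ ⟨a, h'⟩ => ⟨a + n, by
    rw [iterate_add_apply, h, ← iterate_add_apply, add_comm a n, iterate_add_apply, h',
      ← iterate_add_apply]⟩

theorem sameComponent_iterate_right (g : α → α) (x : α) (n : ℕ) : SameComponent g x (g^[n] x) :=
  ⟨n, 0, rfl⟩

theorem SameComponent.symm (h : SameComponent g x y) : SameComponent g y x :=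
  (equivalence_sameComponent g).symm h

theorem SameComponent.trans {z : α} (h : SameComponent g x y) (h' : SameComponent g y z) :
    SameComponent g x z :=
  (equivalence_sameComponent g).trans h h'

theorem SameComponent.setOf_eq (h : SameComponent g x y) :
    {z | SameComponent g x z} = {z | SameComponent g y z} :=
  setOf_rel_eq (equivalence_sameComponent g) h

theorem SameFoil.refl (g : α → α) (x : α) : SameFoil g x x := ⟨0, rfl⟩

theorem SameFoil.symm (h : SameFoil g x y) : SameFoil g y x :=
  (equivalence_sameFoil g).symm h

theorem SameFoil.trans {z : α} (h : SameFoil g x y) (h' : SameFoil g y z) : SameFoil g x z :=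
  (equivalence_sameFoil g).trans h h'

theorem SameFoil.setOf_eq (h : SameFoil g x y) : {z | SameFoil g x z} = {z | SameFoil g y z} :=
  setOf_rel_eq (equivalence_sameFoil g) h

theorem SameFoil.sameComponent (h : SameFoil g x y) : SameComponent g x y :=
  let ⟨n, h⟩ := h
  ⟨n, n, h⟩

theorem sameFoil_iterate_iff (n : ℕ) : SameFoil g (g^[n] x) (g^[n] y) ↔ SameFoil g x y := by
  constructor
  · rintro ⟨k, h⟩
    exact ⟨k + n, by rwa [iterate_add_apply, iterate_add_apply]⟩
  · rintro ⟨k, h⟩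
    exact ⟨k, by rw [← iterate_add_apply, ← iterate_add_apply, add_comm, iterate_add_apply, h,
      ← iterate_add_apply]⟩

theorem SameComponent.exists_sameFoil (h : SameComponent g x y) :
    (∃ n, SameFoil g (g^[n] x) y) ∨ ∃ n, SameFoil g x (g^[n] y) := by
  obtain ⟨n, k, h⟩ := h
  rcases le_total k n with hkn | hnk
  · exact Or.inl ⟨n - k, k, by rw [← iterate_add_apply, Nat.add_sub_cancel' hkn, h]⟩
  · exact Or.inr ⟨k - n, n, by rw [← iterate_add_apply, Nat.add_sub_cancel' hnk, h]⟩

theorem SameComponent.exists_iterate_eq (h : SameComponent g x y) (hy : y ∈ periodicPts g) :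
    ∃ n, g^[n] x = y := by
  obtain ⟨n, k, h⟩ := h
  obtain ⟨d, hd, hper⟩ := hy
  refine ⟨(k * d - k) + n, ?_⟩
  rw [iterate_add_apply, h, ← iterate_add_apply, Nat.sub_add_cancel (Nat.le_mul_of_pos_right k hd)]
  exact (hper.const_mul k).eq

theorem mapsTo_primevalPts (g : α → α) : Set.MapsTo g (primevalPts g) (primevalPts g) := by
  intro y hy n
  obtain ⟨x, rfl⟩ := hy n
  exact ⟨g x, by rw [← iterate_succ_apply, iterate_succ_apply']⟩

theorem periodicPts_subset_primevalPts (g : α → α) : periodicPts g ⊆ primevalPts g := by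
  rintro y ⟨d, hd, hper⟩ n
  refine ⟨g^[n * d - n] y, ?_⟩
  rw [← iterate_add_apply, Nat.add_sub_cancel' (Nat.le_mul_of_pos_right n hd)]
  exact (hper.const_mul n).eq

theorem nonempty_iInter_of_antitone_finite {A : ℕ → Set α} (hA : Antitone A)
    (hfin : (A 0).Finite) (hne : ∀ n, (A n).Nonempty) : (⋂ n, A n).Nonempty := by
  let _ : TopologicalSpace α := ⊥
  have : DiscreteTopology α := ⟨rfl⟩
  exact IsCompact.nonempty_iInter_of_sequence_nonempty_isCompact_isClosed A
    (fun n => hA n.le_succ) hne hfin.isCompact fun n => isClosed_discrete _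

theorem exists_mem_primevalPts {s : Set α} (hs : s.Finite) (h : ∀ n : ℕ, ∃ z, g^[n] z ∈ s) :
    ∃ x ∈ s, x ∈ primevalPts g := by
  have hanti : Antitone fun n => s ∩ Set.range g^[n] := by
    rintro n k hnk x ⟨hx, z, rfl⟩
    exact ⟨hx, g^[k - n] z, by rw [← iterate_add_apply, Nat.add_sub_cancel' hnk]⟩
  obtain ⟨x, hx⟩ := nonempty_iInter_of_antitone_finite hanti (hs.inter_of_left _) fun n =>
    let ⟨z, hz⟩ := h n
    ⟨g^[n] z, hz, z, rfl⟩
  rw [Set.mem_iInter] at hx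
  exact ⟨x, (hx 0).1, fun n => (hx n).2⟩

theorem surjOn_primevalPts (hfib : ∀ y, {x | g x = y}.Finite) :
    Set.SurjOn g (primevalPts g) (primevalPts g) := by
  intro y hy
  obtain ⟨x, hxy, hx⟩ := exists_mem_primevalPts (g := g) (hfib y) fun n =>
    let ⟨z, hz⟩ := hy (n + 1)
    ⟨z, by rwa [iterate_succ_apply'] at hz⟩
  exact ⟨x, hx, hxy⟩

theorem SameFoil.eq_of_injOn {s : Set α} (hmaps : Set.MapsTo g s s) (hinj : Set.InjOn g s)
    (h : SameFoil g x y) (hx : x ∈ s) (hy : y ∈ s) : x = y :=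
  let ⟨n, h⟩ := h
  hinj.iterate hmaps n hx hy h

section Cycles

theorem isDirectedCycleIn_periodicOrbit (hy : y ∈ periodicPts g) :
    IsDirectedCycleIn (mapGraph g) {z | SameComponent g y z} (periodicOrbit g y) := by
  refine ⟨?_, nodup_periodicOrbit, ?_, ?_⟩
  · rwa [Ne, periodicOrbit_eq_nil_iff_not_periodic_pt, not_not]
  · rw [periodicOrbit_chain' _ hy]
    exact fun n => (iterate_succ_apply' g n y).symm
  · intro x hx
    obtain ⟨n, rfl⟩ := (mem_periodicOrbit_iff hy).1 hx
    exact sameComponent_iterate_right g y n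

theorem eq_iterate_of_isChain {a : α} {l : List α} (h : (a :: l).IsChain fun x y => g x = y) :
    a :: l = List.iterate g a (l.length + 1) := by
  induction l generalizing a with
  | nil => rfl
  | cons b l ih =>
    obtain ⟨rfl, h⟩ := List.isChain_cons_cons.1 h
    exact congrArg (a :: ·) (ih h)

theorem coe_iterate_eq_periodicOrbit {n : ℕ} (hn : 0 < n) (hx : IsPeriodicPt g n x)
    (hnodup : (List.iterate g x n).Nodup) : (List.iterate g x n : Cycle α) = periodicOrbit g x := by
  rw [← List.range_map_iterate] at hnodup
  have hmin : minimalPeriod g x = n := by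
    refine (hx.minimalPeriod_le hn).eq_of_not_lt fun hlt => (hx.minimalPeriod_pos hn).ne' ?_
    exact List.inj_on_of_nodup_map hnodup (List.mem_range.2 hlt) (List.mem_range.2 hn)
      iterate_minimalPeriod
  rw [periodicOrbit_def, hmin, List.range_map_iterate]

theorem exists_eq_periodicOrbit_of_isDirectedCycleIn {C : Set α} {c : Cycle α}
    (hc : IsDirectedCycleIn (mapGraph g) C c) :
    ∃ y ∈ C, y ∈ periodicPts g ∧ c = periodicOrbit g y := by
  obtain ⟨hnil, hnodup, hchain, hC⟩ := hc
  induction c using Quotient.inductionOn' with | h l => ?_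
  cases l with
  | nil => exact absurd rfl hnil
  | cons a l =>
    have hiter : (a :: l) ++ [a] = List.iterate g a (l.length + 1) ++ [g^[l.length + 1] a] := by
      have h := eq_iterate_of_isChain (g := g) (l := l ++ [a]) hchain
      rwa [List.length_append, List.length_singleton, List.iterate_add] at h
    obtain ⟨hl, ha⟩ := List.append_inj' hiter rfl
    have hper : IsPeriodicPt g (l.length + 1) a := (List.singleton_inj.1 ha).symm
    refine ⟨a, hC a List.mem_cons_self, ⟨_, l.length.succ_pos, hper⟩, ?_⟩
    change ((a :: l : List α) : Cycle α) = _
    have hnodup' : (a :: l).Nodup := hnodup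
    rw [hl] at hnodup' ⊢
    exact coe_iterate_eq_periodicOrbit l.length.succ_pos hper hnodup'

theorem periodicOrbit_eq_of_sameComponent (h : SameComponent g x y) (hx : x ∈ periodicPts g)
    (hy : y ∈ periodicPts g) : periodicOrbit g x = periodicOrbit g y := by
  obtain ⟨n, rfl⟩ := h.exists_iterate_eq hy
  exact (periodicOrbit_apply_iterate_eq hx n).symm

theorem finite_setOf_mem_periodicOrbit (g : α → α) (y : α) : {x | x ∈ periodicOrbit g y}.Finite :=
  List.finite_toSet ((List.range (minimalPeriod g y)).map fun n => g^[n] y)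

theorem setOf_sameComponent_inter_periodicPts (hy : y ∈ periodicPts g) :
    {z | SameComponent g y z} ∩ periodicPts g = {z | z ∈ periodicOrbit g y} := by
  ext z
  constructor
  · rintro ⟨hyz, hz⟩
    exact (mem_periodicOrbit_iff hy).2 (hyz.exists_iterate_eq hz)
  · intro hz
    obtain ⟨n, rfl⟩ := (mem_periodicOrbit_iff hy).1 hz
    exact ⟨sameComponent_iterate_right g y n, (bijOn_periodicPts g).mapsTo.iterate n hy⟩

end Cycles

section FiniteComponents

variable (hfin : {z | SameComponent g x z}.Finite)
include hfin

theorem exists_sameComponent_mem_periodicPts : ∃ y ∈ periodicPts g, SameComponent g x y := by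
  have hmaps : Set.MapsTo (fun n => g^[n] x) Set.univ {y | SameComponent g x y} :=
    fun n _ => sameComponent_iterate_right g x n
  obtain ⟨a, -, b, -, hab, h⟩ := Set.infinite_univ.exists_lt_map_eq_of_mapsTo hmaps hfin
  refine ⟨g^[a] x, ⟨b - a, Nat.sub_pos_of_lt hab, ?_⟩, sameComponent_iterate_right g x a⟩
  rw [IsPeriodicPt, IsFixedPt, ← iterate_add_apply, Nat.sub_add_cancel hab.le]
  exact h.symm

theorem mem_periodicPts_of_mem_primevalPts (hx : x ∈ primevalPts g) : x ∈ periodicPts g := by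
  choose z hz using hx
  have hmaps : Set.MapsTo z Set.univ {y | SameComponent g x y} := fun n _ => ⟨0, n, (hz n).symm⟩
  obtain ⟨a, -, b, -, hab, h⟩ := Set.infinite_univ.exists_lt_map_eq_of_mapsTo hmaps hfin
  refine ⟨b - a, Nat.sub_pos_of_lt hab, ?_⟩
  calc g^[b - a] x = g^[b - a] (g^[a] (z b)) := by rw [← h, hz]
    _ = x := by rw [← iterate_add_apply, Nat.sub_add_cancel hab.le, hz]

theorem primevalPts_inter_setOf_sameComponent (hy : y ∈ periodicPts g)
    (hxy : SameComponent g x y) :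
    primevalPts g ∩ {z | SameComponent g x z} = {z | z ∈ periodicOrbit g y} := by
  rw [← setOf_sameComponent_inter_periodicPts hy, Set.inter_comm, hxy.setOf_eq] at *
  refine Set.Subset.antisymm (fun z hz => ⟨hz.1, ?_⟩)
    (Set.inter_subset_inter_right _ (periodicPts_subset_primevalPts g))
  exact mem_periodicPts_of_mem_primevalPts (SameComponent.setOf_eq hz.1 ▸ hfin) hz.2

end FiniteComponents

theorem foilsOf_eq_image (hy : y ∈ periodicPts g) (hxy : SameComponent g x y) :
    foilsOf g x = (fun n => {z | SameFoil g (g^[n] y) z}) '' Set.Iio (minimalPeriod g y) := by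
  ext L
  constructor
  · rintro ⟨z, hxz, rfl⟩
    obtain ⟨n, hn⟩ := (hxz.symm.trans hxy).exists_iterate_eq hy
    obtain ⟨k, hk⟩ := (sameComponent_iterate_right g y n).symm.exists_iterate_eq hy
    refine ⟨k % minimalPeriod g y,
      Nat.mod_lt _ (minimalPeriod_pos_of_mem_periodicPts hy), SameFoil.setOf_eq ⟨n, ?_⟩⟩
    rw [iterate_mod_minimalPeriod_eq, ← iterate_add_apply, add_comm, iterate_add_apply, hk, hn]
  · rintro ⟨n, -, rfl⟩
    exact ⟨_, hxy.trans (sameComponent_iterate_right g y n), rfl⟩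

theorem injOn_setOf_sameFoil_iterate (hy : y ∈ periodicPts g) :
    Set.InjOn (fun n => {z | SameFoil g (g^[n] y) z}) (Set.Iio (minimalPeriod g y)) := by
  intro n hn k hk h
  have hper := (bijOn_periodicPts g).mapsTo
  have hfoil : g^[k] y ∈ {z | SameFoil g (g^[n] y) z} := by
    rw [show {z | SameFoil g (g^[n] y) z} = {z | SameFoil g (g^[k] y) z} from h]
    exact SameFoil.refl g _
  exact iterate_injOn_Iio_minimalPeriod hn hk (SameFoil.eq_of_injOn hper
    (bijOn_periodicPts g).injOn hfoil (hper.iterate n hy) (hper.iterate k hy))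

theorem finite_foilsOf (hy : y ∈ periodicPts g) (hxy : SameComponent g x y) :
    (foilsOf g x).Finite := by
  rw [foilsOf_eq_image hy hxy]
  exact (Set.finite_Iio _).image _

theorem ncard_foilsOf (hy : y ∈ periodicPts g) (hxy : SameComponent g x y) :
    (foilsOf g x).ncard = minimalPeriod g y := by
  rw [foilsOf_eq_image hy hxy, (injOn_setOf_sameFoil_iterate hy).ncard_image,
    ← Finset.coe_Iio, Set.ncard_coe_finset, Nat.card_Iio]

section IntegerOrbits

variable {p q : ℤ → α}

theorem iterate_apply_intOrbit (hp : ∀ n, g (p n) = p (n + 1)) (j : ℕ) (k : ℤ) :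
    g^[j] (p k) = p (k + j) := by
  induction j with
  | zero => simp
  | succ j ih => rw [iterate_succ_apply', ih, hp, Nat.cast_succ, add_assoc]

theorem intOrbit_mem_primevalPts (hp : ∀ n, g (p n) = p (n + 1)) (k : ℤ) :
    p k ∈ primevalPts g :=
  fun n => ⟨p (k - n), by rw [iterate_apply_intOrbit hp, sub_add_cancel]⟩

theorem sameComponent_intOrbit (hp : ∀ n, g (p n) = p (n + 1)) (k : ℤ) :
    SameComponent g (p 0) (p k) := by
  refine ⟨k.toNat, (-k).toNat, ?_⟩
  rw [iterate_apply_intOrbit hp, iterate_apply_intOrbit hp]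
  congr 1
  omega

theorem exists_intOrbit {s : Set α} (hs : Set.SurjOn g s s) (hy : y ∈ s) :
    ∃ p : ℤ → α, p 0 = y ∧ ∀ n, g (p n) = p (n + 1) := by
  choose u hu using fun z : s => hs z.2
  let v : s → s := fun z => ⟨u z, (hu z).1⟩
  have hv : ∀ z, g (v z) = z := fun z => (hu z).2
  refine ⟨fun | .ofNat n => g^[n] y | .negSucc n => v^[n + 1] ⟨y, hy⟩, rfl, ?_⟩
  rintro (n | n | n)
  · exact (iterate_succ_apply' g n y).symm
  · exact hv _
  · change g (v^[n + 1 + 1] ⟨y, hy⟩ : s) = (v^[n + 1] ⟨y, hy⟩ : s)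
    rw [iterate_succ_apply', hv]

variable (hinj : Set.InjOn g (primevalPts g))
include hinj

theorem primevalPts_inter_setOf_sameComponent_eq_range (hp : ∀ n, g (p n) = p (n + 1)) :
    primevalPts g ∩ {z | SameComponent g (p 0) z} = Set.range p := by
  ext z
  constructor
  · rintro ⟨hz, n, k, h⟩
    refine ⟨n - k, hinj.iterate (mapsTo_primevalPts g) k (intOrbit_mem_primevalPts hp _) hz ?_⟩
    rw [← h, iterate_apply_intOrbit hp, iterate_apply_intOrbit hp, sub_add_cancel, zero_add]
  · rintro ⟨n, rfl⟩
    exact ⟨intOrbit_mem_primevalPts hp n, sameComponent_intOrbit hp n⟩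

theorem intOrbit_eq_add_of_apply_zero_eq (hp : ∀ n, g (p n) = p (n + 1))
    (hq : ∀ n, g (q n) = q (n + 1)) {k : ℤ} (h : q 0 = p k) (n : ℤ) : q n = p (n + k) := by
  refine hinj.iterate (mapsTo_primevalPts g) (-n).toNat (intOrbit_mem_primevalPts hq n)
    (intOrbit_mem_primevalPts hp _) ?_
  calc g^[(-n).toNat] (q n) = g^[n.toNat] (q 0) := by
        rw [iterate_apply_intOrbit hq, iterate_apply_intOrbit hq]; congr 1; omega
    _ = g^[(-n).toNat] (p (n + k)) := by
        rw [h, iterate_apply_intOrbit hp, iterate_apply_intOrbit hp]; congr 1; omega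

end IntegerOrbits

section FiniteSelections

/-- No infinite class of the relation `r` has a nonempty finite intersection with `D`. -/
def NoFiniteSelection (r : α → α → Prop) (D : Set α) : Prop :=
  ∀ y ∈ D, ({z | r y z} ∩ D).Finite → {z | r y z}.Finite

theorem NoFiniteSelection.congr {r r' : α → α → Prop} {D D' : Set α} (h : NoFiniteSelection r D)
    (hr : ∀ x y, r' x y ↔ r x y) (hD : ∀ x, x ∈ D' ↔ x ∈ D) : NoFiniteSelection r' D' := by
  obtain rfl : r' = r := funext₂ fun x y => propext (hr x y)
  obtain rfl : D' = D := Set.ext hD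
  exact h

/-- The points of the last finite foil of their component. -/
def lastFiniteFoilPts (g : α → α) : Set α :=
  {y | {z | SameFoil g y z}.Finite ∧ {z | SameFoil g (g y) z}.Infinite}

/-- The points whose foil is finite and has no junior foil. -/
def youngestFiniteFoilPts (g : α → α) : Set α :=
  {y | {z | SameFoil g y z}.Finite ∧ ∀ z, ¬ SameFoil g y (g z)}

theorem notMem_periodicPts (h : NoFiniteSelection (SameComponent g) (periodicPts g))
    (hinf : {z | SameComponent g y z}.Infinite) : y ∉ periodicPts g := fun hy =>
  hinf (h y hy (setOf_sameComponent_inter_periodicPts hy ▸ finite_setOf_mem_periodicOrbit g y))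

theorem isAcyclicIn_setOf_sameComponent
    (h : NoFiniteSelection (SameComponent g) (periodicPts g))
    (hinf : {z | SameComponent g x z}.Infinite) :
    IsAcyclicIn (mapGraph g) {z | SameComponent g x z} := by
  intro c hc
  obtain ⟨y, hxy, hy, -⟩ := exists_eq_periodicOrbit_of_isDirectedCycleIn hc
  exact notMem_periodicPts h (SameComponent.setOf_eq hxy ▸ hinf) hy

theorem finite_setOf_sameFoil_of_iterate (hfib : ∀ y, {x | g x = y}.Finite) {n : ℕ}
    (h : {z | SameFoil g (g^[n] x) z}.Finite) : {z | SameFoil g x z}.Finite := by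
  induction n with
  | zero => exact h
  | succ n ih =>
    refine ih ((h.biUnion fun y _ => hfib y).subset fun z hz =>
      Set.mem_biUnion (x := g z) ?_ (Set.mem_ofPred.2 rfl))
    rw [iterate_succ_apply']
    exact (sameFoil_iterate_iff 1).2 hz

theorem SameComponent.sameFoil_of_lastFiniteFoilPts (hfib : ∀ y, {x | g x = y}.Finite)
    (h : SameComponent g x y) (hx : x ∈ lastFiniteFoilPts g) (hy : y ∈ lastFiniteFoilPts g) :
    SameFoil g x y := by
  have key : ∀ {u v}, u ∈ lastFiniteFoilPts g → v ∈ lastFiniteFoilPts g →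
      ∀ n, SameFoil g (g^[n] u) v → SameFoil g u v := by
    rintro u v hu hv (_ | n) h
    · exact h
    · exact absurd (finite_setOf_sameFoil_of_iterate hfib (h.setOf_eq ▸ hv.1)) hu.2
  rcases h.exists_sameFoil with ⟨n, h⟩ | ⟨n, h⟩
  · exact key hx hy n h
  · exact (key hy hx n h.symm).symm

theorem SameComponent.sameFoil_of_youngestFiniteFoilPts (h : SameComponent g x y)
    (hx : x ∈ youngestFiniteFoilPts g) (hy : y ∈ youngestFiniteFoilPts g) : SameFoil g x y := by
  have key : ∀ {u v}, u ∈ youngestFiniteFoilPts g → ∀ n, SameFoil g u (g^[n] v) →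
      SameFoil g u v := by
    rintro u v hu (_ | n) h
    · exact h
    · rw [iterate_succ_apply'] at h
      exact absurd h (hu.2 _)
  rcases h.exists_sameFoil with ⟨n, h⟩ | ⟨n, h⟩
  · exact (key hy n h.symm).symm
  · exact key hx n h

theorem notMem_lastFiniteFoilPts (hfib : ∀ y, {x | g x = y}.Finite)
    (h : NoFiniteSelection (SameComponent g) (lastFiniteFoilPts g))
    (hinf : {z | SameComponent g y z}.Infinite) : y ∉ lastFiniteFoilPts g := fun hy =>
  hinf (h y hy (hy.1.subset fun _ hz => hz.1.sameFoil_of_lastFiniteFoilPts hfib hy hz.2))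

theorem notMem_youngestFiniteFoilPts
    (h : NoFiniteSelection (SameComponent g) (youngestFiniteFoilPts g))
    (hinf : {z | SameComponent g y z}.Infinite) : y ∉ youngestFiniteFoilPts g := fun hy =>
  hinf (h y hy (hy.1.subset fun _ hz => hz.1.sameFoil_of_youngestFiniteFoilPts hy hz.2))

theorem finite_setOf_sameFoil_iterate_iff (hfib : ∀ y, {x | g x = y}.Finite)
    (h : NoFiniteSelection (SameComponent g) (lastFiniteFoilPts g))
    (hinf : {z | SameComponent g y z}.Infinite) (n : ℕ) :
    {z | SameFoil g (g^[n] y) z}.Finite ↔ {z | SameFoil g y z}.Finite := by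
  refine ⟨finite_setOf_sameFoil_of_iterate hfib, fun hy => ?_⟩
  induction n with
  | zero => exact hy
  | succ n ih =>
    by_contra hn
    rw [iterate_succ_apply'] at hn
    exact notMem_lastFiniteFoilPts hfib h
      ((sameComponent_iterate_right g y n).setOf_eq ▸ hinf) ⟨ih, hn⟩

theorem SameComponent.finite_setOf_sameFoil_iff (hxy : SameComponent g x y)
    (hfib : ∀ y, {x | g x = y}.Finite)
    (h : NoFiniteSelection (SameComponent g) (lastFiniteFoilPts g))
    (hinf : {z | SameComponent g x z}.Infinite) :
    {z | SameFoil g x z}.Finite ↔ {z | SameFoil g y z}.Finite := by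
  obtain ⟨n, k, hnk⟩ := id hxy
  rw [← finite_setOf_sameFoil_iterate_iff hfib h hinf n, hnk,
    finite_setOf_sameFoil_iterate_iff hfib h (hxy.setOf_eq ▸ hinf) k]

theorem foilsOf_finite_or_infinite (hfib : ∀ y, {x | g x = y}.Finite)
    (h : NoFiniteSelection (SameComponent g) (lastFiniteFoilPts g))
    (hinf : {z | SameComponent g x z}.Infinite) :
    (∀ L ∈ foilsOf g x, L.Finite) ∨ ∀ L ∈ foilsOf g x, L.Infinite := by
  by_cases hx : {z | SameFoil g x z}.Finite
  · refine Or.inl ?_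
    rintro L ⟨y, hy, rfl⟩
    exact (hy.finite_setOf_sameFoil_iff hfib h hinf).1 hx
  · refine Or.inr ?_
    rintro L ⟨y, hy, rfl⟩
    exact fun hL => hx ((hy.finite_setOf_sameFoil_iff hfib h hinf).2 hL)

section FiniteFoils

variable (h : NoFiniteSelection (SameComponent g) (youngestFiniteFoilPts g))
  (hinf : {z | SameComponent g x z}.Infinite) (hfoils : ∀ L ∈ foilsOf g x, L.Finite)
include h hinf hfoils

theorem exists_sameFoil_apply (hxy : SameComponent g x y) : ∃ z, SameFoil g y (g z) := by
  by_contra! hy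
  exact notMem_youngestFiniteFoilPts h (hxy.setOf_eq ▸ hinf) ⟨hfoils _ ⟨y, hxy, rfl⟩, hy⟩

theorem exists_sameFoil_iterate (n : ℕ) : ∃ z, SameFoil g x (g^[n] z) := by
  induction n with
  | zero => exact ⟨x, SameFoil.refl g x⟩
  | succ n ih =>
    obtain ⟨z, hz⟩ := ih
    obtain ⟨w, hw⟩ := exists_sameFoil_apply h hinf hfoils
      (hz.sameComponent.trans (sameComponent_iterate_right g z n).symm)
    exact ⟨w, hz.trans ((sameFoil_iterate_iff n).2 hw)⟩

theorem exists_mem_primevalPts_sameFoil : ∃ y ∈ primevalPts g, SameFoil g x y :=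
  let ⟨y, hxy, hy⟩ := exists_mem_primevalPts (hfoils _ ⟨x, ⟨0, 0, rfl⟩, rfl⟩) fun n =>
    exists_sameFoil_iterate h hinf hfoils n
  ⟨y, hy, hxy⟩

theorem exists_biInfinitePath (hfib : ∀ y, {x | g x = y}.Finite)
    (hinj : Set.InjOn g (primevalPts g)) :
    ∃ p : ℤ → α, IsBiInfinitePathIn (mapGraph g) {z | SameComponent g x z} p ∧
      primevalPts g ∩ {z | SameComponent g x z} = Set.range p ∧
      ∀ q : ℤ → α, IsBiInfinitePathIn (mapGraph g) {z | SameComponent g x z} q →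
        ∃ k : ℤ, ∀ n : ℤ, q n = p (n + k) := by
  obtain ⟨y, hy, hxy⟩ := exists_mem_primevalPts_sameFoil h hinf hfoils
  obtain ⟨p, rfl, hp⟩ := exists_intOrbit (surjOn_primevalPts hfib) hy
  rw [hxy.sameComponent.setOf_eq]
  have hrange := primevalPts_inter_setOf_sameComponent_eq_range hinj hp
  refine ⟨p, fun n => ⟨sameComponent_intOrbit hp n, hp n⟩, hrange, fun q hq => ?_⟩
  have hadj : ∀ n, g (q n) = q (n + 1) := fun n => (hq n).2
  obtain ⟨k, hk⟩ : q 0 ∈ Set.range p :=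
    hrange ▸ ⟨intOrbit_mem_primevalPts hadj 0, (hq 0).1⟩
  exact ⟨k, intOrbit_eq_add_of_apply_zero_eq hinj hp hadj hk.symm⟩

end FiniteFoils

theorem notMem_primevalPts (hinj : Set.InjOn g (primevalPts g))
    (h : NoFiniteSelection (SameFoil g) (primevalPts g))
    (hinf : {z | SameFoil g y z}.Infinite) : y ∉ primevalPts g := fun hy =>
  hinf (h y hy ((Set.finite_singleton y).subset fun _ hz =>
    (SameFoil.eq_of_injOn (mapsTo_primevalPts g) hinj hz.1 hy hz.2).symm))

/-- The properties that mass transport forces on the self-map of the points of a point process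
given by a point-shift. -/
structure IsMassTransportRegular (g : α → α) : Prop where
  finite_fiber : ∀ y, {x | g x = y}.Finite
  injOn_primevalPts : Set.InjOn g (primevalPts g)
  periodicPts : NoFiniteSelection (SameComponent g) (periodicPts g)
  lastFiniteFoilPts : NoFiniteSelection (SameComponent g) (lastFiniteFoilPts g)
  youngestFiniteFoilPts : NoFiniteSelection (SameComponent g) (youngestFiniteFoilPts g)
  primevalPts : NoFiniteSelection (SameFoil g) (primevalPts g)

end FiniteSelections

end Dynamics

section FunctionalGraphs

open Function

variable {α : Type*} {S : Set α} {f : α → α}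

section Restrict

variable (hf : Set.MapsTo f S S)
include hf

theorem iterate_restrict_eq_iff {x y : S} {n k : ℕ} :
    (hf.restrict f S S)^[n] x = (hf.restrict f S S)^[k] y ↔ f^[n] x = f^[k] y := by
  rw [← Subtype.coe_inj, hf.coe_iterate_restrict, hf.coe_iterate_restrict]

theorem sameComponent_restrict_iff {x y : S} :
    SameComponent (hf.restrict f S S) x y ↔ SameComponent f x y :=
  exists₂_congr fun _ _ => iterate_restrict_eq_iff hf

theorem sameFoil_restrict_iff {x y : S} :
    SameFoil (hf.restrict f S S) x y ↔ SameFoil f x y :=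
  exists_congr fun _ => iterate_restrict_eq_iff hf

theorem mem_periodicPts_restrict_iff {x : S} :
    x ∈ periodicPts (hf.restrict f S S) ↔ (x : α) ∈ periodicPts f :=
  exists_congr fun _ => and_congr_right fun _ => iterate_restrict_eq_iff (k := 0) hf

theorem functionalGraph_eq : functionalGraph S f = mapGraph (hf.restrict f S S) := by
  ext x y
  exact Subtype.coe_inj (a := hf.restrict f S S x)

theorem foil_eq (x : S) : foil S f x = {y | SameFoil (hf.restrict f S S) x y} :=
  Set.ext fun _ => (sameFoil_restrict_iff hf).symm

theorem primevalPoints_eq : primevalPoints S f = primevalPts (hf.restrict f S S) :=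
  Set.ext fun _ => forall_congr' fun _ => exists_congr fun _ =>
    (iterate_restrict_eq_iff (k := 0) hf).symm

theorem foilsIn_setOf_sameComponent (x : S) :
    foilsIn S f {y | SameComponent (hf.restrict f S S) x y} = foilsOf (hf.restrict f S S) x := by
  ext L
  constructor
  · rintro ⟨⟨y, rfl⟩, hL⟩
    rw [foil_eq hf] at hL ⊢
    exact ⟨y, hL (SameFoil.refl _ y), rfl⟩
  · rintro ⟨y, hy, rfl⟩
    exact ⟨⟨y, (foil_eq hf y).symm⟩, fun z hz => hy.trans (SameFoil.sameComponent hz)⟩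

end Restrict

theorem reachable_iterate (g : α → α) (x : α) (n : ℕ) :
    (mapGraph g).toSimpleGraphInclusive.Reachable x (g^[n] x) := by
  induction n with
  | zero => exact SimpleGraph.Reachable.refl _
  | succ n ih =>
    refine ih.trans ?_
    rw [iterate_succ_apply']
    by_cases h : g^[n] x = g (g^[n] x)
    · rw [← h]
    · exact SimpleGraph.Adj.reachable ((SimpleGraph.fromRel_adj _ _ _).2 ⟨h, Or.inl rfl⟩)

theorem reachable_mapGraph_iff {g : α → α} {x y : α} :
    (mapGraph g).toSimpleGraphInclusive.Reachable x y ↔ SameComponent g x y := by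
  constructor
  · rintro ⟨w⟩
    induction w with
    | nil => exact ⟨0, 0, rfl⟩
    | cons h _ ih =>
      refine SameComponent.trans ?_ ih
      rcases ((SimpleGraph.fromRel_adj _ _ _).1 h).2 with h | h
      · exact ⟨1, 0, h⟩
      · exact ⟨0, 1, h.symm⟩
  · rintro ⟨n, k, h⟩
    exact (reachable_iterate g x n).trans (h ▸ (reachable_iterate g y k).symm)

theorem supp_connectedComponentMk (hf : Set.MapsTo f S S) (x : S) :
    ((functionalGraph S f).toSimpleGraphInclusive.connectedComponentMk x).supp =
      {y | SameComponent (hf.restrict f S S) x y} := by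
  ext y
  rw [SimpleGraph.ConnectedComponent.mem_supp_iff, SimpleGraph.ConnectedComponent.eq,
    functionalGraph_eq hf, reachable_mapGraph_iff]
  exact ⟨SameComponent.symm, SameComponent.symm⟩

theorem structureFF_of_isClassFF (hf : Set.MapsTo f S S) {C : FunctionalComponent S f}
    (hC : IsClassFF S f C) : StructureFF S f C := by
  induction C using SimpleGraph.ConnectedComponent.ind with | h x => ?_
  unfold IsClassFF at hC
  unfold StructureFF
  rw [supp_connectedComponentMk hf] at hC ⊢
  rw [foilsIn_setOf_sameComponent hf, primevalPoints_eq hf, functionalGraph_eq hf]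
  obtain ⟨y, hy, hxy⟩ := exists_sameComponent_mem_periodicPts hC
  have hcard := ncard_foilsOf hy hxy
  refine ⟨?_, finite_foilsOf hy hxy, hcard ▸ minimalPeriod_pos_of_mem_periodicPts hy,
    periodicOrbit _ y, hxy.setOf_eq ▸ isDirectedCycleIn_periodicOrbit hy, fun c hc => ?_,
    periodicOrbit_length.trans hcard.symm, primevalPts_inter_setOf_sameComponent hC hy hxy⟩
  · rintro L ⟨z, hxz, rfl⟩
    exact hC.subset fun w hw => hxz.trans (SameFoil.sameComponent hw)
  · obtain ⟨z, hxz, hz, rfl⟩ := exists_eq_periodicOrbit_of_isDirectedCycleIn hc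
    exact periodicOrbit_eq_of_sameComponent ((SameComponent.symm hxz).trans hxy) hz hy

namespace IsMassTransportRegular

variable {hf : Set.MapsTo f S S} (hg : IsMassTransportRegular (hf.restrict f S S))
  {C : FunctionalComponent S f}
include hg

theorem isClass : IsClassFF S f C ∨ IsClassIF S f C ∨ IsClassII S f C := by
  induction C using SimpleGraph.ConnectedComponent.ind with | h x => ?_
  unfold IsClassFF IsClassIF IsClassII
  rw [supp_connectedComponentMk hf, foilsIn_setOf_sameComponent hf, ← and_or_left]
  exact (Set.finite_or_infinite _).imp_right fun hinf =>
    ⟨hinf, foilsOf_finite_or_infinite hg.finite_fiber hg.lastFiniteFoilPts hinf⟩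

theorem structureIF (hC : IsClassIF S f C) : StructureIF S f C := by
  induction C using SimpleGraph.ConnectedComponent.ind with | h x => ?_
  unfold IsClassIF at hC
  unfold StructureIF
  rw [supp_connectedComponentMk hf, foilsIn_setOf_sameComponent hf] at *
  rw [primevalPoints_eq hf, functionalGraph_eq hf]
  obtain ⟨hinf, hfoils⟩ := hC
  refine ⟨isAcyclicIn_setOf_sameComponent hg.periodicPts hinf, ?_,
    exists_biInfinitePath hg.youngestFiniteFoilPts hinf hfoils hg.finite_fiber
      hg.injOn_primevalPts⟩
  rintro L ⟨y, hxy, rfl⟩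
  obtain ⟨z, hz⟩ := exists_sameFoil_apply hg.youngestFiniteFoilPts hinf hfoils hxy
  refine ⟨_, ⟨z, hxy.trans (hz.sameComponent.trans (sameComponent_iterate_right _ z 1).symm), rfl⟩,
    z, _, ?_, hz, (foil_eq hf z).symm⟩
  rw [functionalGraph_eq hf]
  rfl

theorem structureII (hC : IsClassII S f C) : StructureII S f C := by
  induction C using SimpleGraph.ConnectedComponent.ind with | h x => ?_
  unfold IsClassII at hC
  unfold StructureII
  rw [supp_connectedComponentMk hf] at *
  rw [foilsIn_setOf_sameComponent hf] at hC
  rw [primevalPoints_eq hf, functionalGraph_eq hf]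
  refine ⟨isAcyclicIn_setOf_sameComponent hg.periodicPts hC.1,
    Set.disjoint_iff_inter_eq_empty.1 (Set.disjoint_left.2 fun y hy hxy => ?_)⟩
  exact notMem_primevalPts hg.injOn_primevalPts hg.primevalPts (hC.2 _ ⟨y, hxy, rfl⟩) hy

end IsMassTransportRegular

end FunctionalGraphs

section CountingMeasures

variable {X Ω : Type*} [MeasurableSpace X]

theorem countable_pointsOf [MeasurableSingletonClass X] (μ : Measure X) [SFinite μ] :
    (pointsOf μ).Countable :=
  (Measure.countable_meas_pos_of_disjoint_iUnion (fun x => measurableSet_singleton x)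
    fun _ _ h => Set.disjoint_singleton.2 h).mono fun _ hx => pos_iff_ne_zero.2 hx

theorem measure_eq_encard [MeasurableSingletonClass X] {μ : Measure X} [SFinite μ]
    (hμ : μ (pointsOf μ)ᶜ = 0) (hsimple : ∀ x ∈ pointsOf μ, μ {x} = 1) (B : Set X) :
    μ B = ({x : pointsOf μ | (x : X) ∈ B}.encard : ℝ≥0∞) := by
  have hcount : (B ∩ pointsOf μ).Countable := (countable_pointsOf μ).mono Set.inter_subset_right
  have himage : B ∩ pointsOf μ = Subtype.val '' {x : pointsOf μ | (x : X) ∈ B} :=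
    ((Subtype.image_preimage_coe _ _).trans (Set.inter_comm _ _)).symm
  calc μ B = μ (⋃ x ∈ B ∩ pointsOf μ, {x}) := by
        rw [Set.biUnion_of_singleton, measure_inter_conull hμ]
    _ = ∑' x : ↥(B ∩ pointsOf μ), μ {(x : X)} :=
        measure_biUnion hcount (fun _ _ _ _ h => Set.disjoint_singleton.2 h)
          fun x _ => measurableSet_singleton x
    _ = ((B ∩ pointsOf μ).encard : ℝ≥0∞) := by
        rw [tsum_congr fun x : ↥(B ∩ pointsOf μ) => hsimple x x.2.2, ENNReal.tsum_set_one]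
    _ = ({x : pointsOf μ | (x : X) ∈ B}.encard : ℝ≥0∞) := by
        rw [himage, Subtype.val_injective.encard_image]

variable [TopologicalSpace X]

theorem measure_compl_pointsOf [SecondCountableTopology X] [OpensMeasurableSpace X]
    {μ : Measure X} [μ.OuterRegular]
    (hμ : ∀ B, MeasurableSet B → ∃ n : ℕ∞, μ B = (n : ℝ≥0∞)) : μ (pointsOf μ)ᶜ = 0 := by
  refine measure_null_of_locally_null _ fun x hx => ?_
  obtain ⟨U, hxU, hU, hlt⟩ := Set.exists_isOpen_lt_of_lt {x} 1
    (not_not.1 hx ▸ zero_lt_one : μ {x} < 1)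
  refine ⟨U, mem_nhdsWithin_of_mem_nhds (hU.mem_nhds (Set.singleton_subset_iff.1 hxU)), ?_⟩
  obtain ⟨n, hn⟩ := hμ U hU.measurableSet
  rw [hn] at hlt ⊢
  exact_mod_cast Order.lt_one_iff.1 (by exact_mod_cast hlt : n < 1)

namespace IsSimplePointProcess

variable [SecondCountableTopology X] [T3Space X] [BorelSpace X] [MeasurableSpace Ω]
  {m : Ω → Measure X} (hm : IsSimplePointProcess m) (ω : Ω)
include hm

theorem apply_eq_encard (B : Set X) :
    m ω B = ({x : pointsOf (m ω) | (x : X) ∈ B}.encard : ℝ≥0∞) :=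
  have := hm.locallyFinite ω
  measure_eq_encard (measure_compl_pointsOf (hm.counting ω)) (hm.simple ω) B

theorem apply_lt_top_iff {p : X → Prop} :
    m ω {x | p x} < ∞ ↔ {x : pointsOf (m ω) | p x}.Finite := by
  rw [hm.apply_eq_encard, ← Set.encard_lt_top_iff]
  norm_cast

theorem apply_ne_zero_iff {p : X → Prop} :
    m ω {x | p x} ≠ 0 ↔ ∃ x : pointsOf (m ω), p x := by
  rw [hm.apply_eq_encard, ← ENat.toENNReal_zero, ENat.toENNReal_inj.ne, Set.encard_ne_zero]
  rfl

theorem apply_le_one_iff {p : X → Prop} :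
    m ω {x | p x} ≤ 1 ↔ ∀ x y : pointsOf (m ω), p x → p y → x = y := by
  rw [hm.apply_eq_encard, ← ENat.toENNReal_one, ENat.toENNReal_le, Set.encard_le_one_iff]
  rfl

theorem one_le_apply_iff {p : X → Prop} :
    1 ≤ m ω {x | p x} ↔ ∃ x : pointsOf (m ω), p x := by
  rw [hm.apply_eq_encard, ← ENat.toENNReal_one, ENat.toENNReal_le, Set.one_le_encard_iff_nonempty]
  rfl

theorem ae_iff {p : X → Prop} : (∀ᵐ x ∂m ω, p x) ↔ ∀ x : pointsOf (m ω), p x := by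
  rw [MeasureTheory.ae_iff, ← not_iff_not, ← ne_eq, hm.apply_ne_zero_iff, not_forall]

end IsSimplePointProcess

end CountingMeasures

section Kernels

open ProbabilityTheory

variable {X Ω : Type*} [MeasurableSpace X] [MeasurableSpace Ω]

theorem isSFiniteKernel_of_forall_measure_univ_lt_top {κ : Kernel Ω X}
    (h : ∀ ω, κ ω Set.univ < ∞) : IsSFiniteKernel κ := by
  classical
  have hmeas (n : ℕ) : MeasurableSet {ω | ⌊(κ ω Set.univ).toReal⌋₊ = n} :=
    Nat.measurable_floor.comp (κ.measurable_coe MeasurableSet.univ).ennreal_toReal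
      (measurableSet_singleton n)
  refine ⟨fun n => Kernel.piecewise (hmeas n) κ 0, fun n => ⟨n + 1, by simp, fun ω => ?_⟩, ?_⟩
  · rw [Kernel.piecewise_apply']
    split_ifs with hω
    · rw [← ENNReal.ofReal_toReal (h ω).ne]
      refine ENNReal.ofReal_le_of_le_toReal ?_
      have hlt := (Nat.lt_floor_add_one (κ ω Set.univ).toReal).le
      rw [show ⌊(κ ω Set.univ).toReal⌋₊ = n from hω] at hlt
      exact_mod_cast hlt
    · exact zero_le
  · ext ω s hs
    rw [Kernel.sum_apply' _ _ hs, tsum_eq_single ⌊(κ ω Set.univ).toReal⌋₊]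
    · rw [Kernel.piecewise_apply']
      exact (if_pos rfl).symm
    · intro n hn
      rw [Kernel.piecewise_apply']
      exact if_neg hn.symm

theorem isSFiniteKernel_of_isLocallyFiniteMeasure [TopologicalSpace X] [SigmaCompactSpace X]
    [T2Space X] [OpensMeasurableSpace X] {κ : Kernel Ω X} (h : ∀ ω, IsLocallyFiniteMeasure (κ ω)) :
    IsSFiniteKernel κ := by
  set B : ℕ → Set X := disjointed (compactCovering X)
  have hB : ∀ n, MeasurableSet (B n) :=
    MeasurableSet.disjointed fun n => (isCompact_compactCovering X n).measurableSet
  have hfin : ∀ n, IsSFiniteKernel (κ.restrict (hB n)) := fun n =>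
    isSFiniteKernel_of_forall_measure_univ_lt_top fun ω => by
      rw [Kernel.restrict_apply, Measure.restrict_apply_univ]
      exact (measure_mono (disjointed_subset _ n)).trans_lt
        (isCompact_compactCovering X n).measure_lt_top
  have hsum : κ = Kernel.sum fun n => κ.restrict (hB n) := by
    ext ω s hs
    simp_rw [Kernel.sum_apply' _ _ hs, Kernel.restrict_apply]
    rw [← Measure.sum_apply _ hs, ← Measure.restrict_iUnion (disjoint_disjointed _) hB,
      iUnion_disjointed, iUnion_compactCovering, Measure.restrict_univ]
  rw [hsum]
  exact Kernel.isSFiniteKernel_sum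

end Kernels

section Invariance

variable {G Y Z W : Type*}

/-- The measurable functions that are invariant under an action. Invariant events and relations are
the case of predicates, i.e. of values in `Prop`. -/
structure IsMeasurableInvariant (G : Type*) [SMul G Z] [MeasurableSpace Z] [MeasurableSpace W]
    (f : Z → W) : Prop where
  measurable : Measurable f
  map_smul : ∀ (c : G) (z : Z), f (c • z) = f z

/-- The measurable maps that commute with an action. -/
structure IsMeasurableEquivariant (G : Type*) [SMul G Z] [SMul G W] [MeasurableSpace Z]
    [MeasurableSpace W] (φ : Z → W) : Prop where
  measurable : Measurable φ
  map_smul : ∀ (c : G) (z : Z), φ (c • z) = c • φ z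

variable [MeasurableSpace Y] [MeasurableSpace Z] [MeasurableSpace W]

instance instMeasurableConstSMulProd [SMul G Y] [SMul G Z] [MeasurableConstSMul G Y]
    [MeasurableConstSMul G Z] : MeasurableConstSMul G (Y × Z) :=
  ⟨fun c => (measurable_fst.const_smul c).prodMk (measurable_snd.const_smul c)⟩

namespace IsMeasurableInvariant

variable [SMul G Z] {V : Type*} [MeasurableSpace V]

theorem measurable_comp {f : Z → W} (hf : IsMeasurableInvariant G f) {h : W → V}
    (hh : Measurable h) : IsMeasurableInvariant G fun z => h (f z) :=
  ⟨hh.comp hf.measurable, fun c z => congrArg h (hf.map_smul c z)⟩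

theorem comp_equivariant [SMul G Y] {f : Z → W} (hf : IsMeasurableInvariant G f) {φ : Y → Z}
    (hφ : IsMeasurableEquivariant G φ) : IsMeasurableInvariant G fun y => f (φ y) :=
  ⟨hf.measurable.comp hφ.measurable, fun c y => by rw [hφ.map_smul, hf.map_smul]⟩

variable {p q : Z → Prop}

theorem and (hp : IsMeasurableInvariant G p) (hq : IsMeasurableInvariant G q) :
    IsMeasurableInvariant G fun z => p z ∧ q z :=
  ⟨hp.measurable.and hq.measurable, fun c z => by rw [hp.map_smul, hq.map_smul]⟩

theorem not (hp : IsMeasurableInvariant G p) : IsMeasurableInvariant G fun z => ¬ p z :=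
  ⟨hp.measurable.not, fun c z => by rw [hp.map_smul]⟩

theorem forall_nat {p : ℕ → Z → Prop} (hp : ∀ n, IsMeasurableInvariant G (p n)) :
    IsMeasurableInvariant G fun z => ∀ n, p n z :=
  ⟨Measurable.forall fun n => (hp n).measurable, fun c z =>
    forall_congr fun n => (hp n).map_smul c z⟩

theorem exists_nat {p : ℕ → Z → Prop} (hp : ∀ n, IsMeasurableInvariant G (p n)) :
    IsMeasurableInvariant G fun z => ∃ n, p n z :=
  ⟨Measurable.exists fun n => (hp n).measurable, fun c z =>
    propext <| exists_congr fun n => ((hp n).map_smul c z).to_iff⟩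

theorem indicator [Zero W] {f : Z → W} (hf : IsMeasurableInvariant G f)
    (hp : IsMeasurableInvariant G p) : IsMeasurableInvariant G ({z | p z}.indicator f) := by
  classical
  refine ⟨hf.measurable.indicator hp.measurable.setOf, fun c z => ?_⟩
  simp only [Set.indicator_apply, Set.mem_ofPred_eq, hf.map_smul, hp.map_smul]

end IsMeasurableInvariant

theorem IsMeasurableEquivariant.comp [SMul G Y] [SMul G Z] [SMul G W] {φ : Z → W}
    (hφ : IsMeasurableEquivariant G φ) {ψ : Y → Z} (hψ : IsMeasurableEquivariant G ψ) :
    IsMeasurableEquivariant G fun y => φ (ψ y) :=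
  ⟨hφ.measurable.comp hψ.measurable, fun c y => by rw [hψ.map_smul, hφ.map_smul]⟩

theorem IsMeasurableEquivariant.eq [SMul G Z] [Group G] [MulAction G W] [MeasurableEq W]
    {φ ψ : Z → W} (hφ : IsMeasurableEquivariant G φ) (hψ : IsMeasurableEquivariant G ψ) :
    IsMeasurableInvariant G fun z => φ z = ψ z :=
  ⟨Measurable.eq hφ.measurable hψ.measurable, fun c z => by
    rw [hφ.map_smul, hψ.map_smul, smul_left_cancel_iff]⟩

end Invariance

section MassTransport

open ProbabilityTheory Measure

section InvariantMeasures

variable {G Y Z : Type*} [MeasurableSpace Y] [MeasurableSpace Z] [SMul G Y] [SMul G Z]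
  [MeasurableConstSMul G Y] [MeasurableConstSMul G Z]

theorem smulInvariantMeasure_withDensity {Q : Measure Z} [SMulInvariantMeasure G Z Q]
    {w : Z → ℝ≥0∞} (hw : IsMeasurableInvariant G w) :
    SMulInvariantMeasure G Z (Q.withDensity w) := by
  refine ⟨fun c s hs => ?_⟩
  rw [withDensity_apply _ hs, withDensity_apply _ (measurable_const_smul c hs),
    ← (measurePreserving_smul c Q).setLIntegral_comp_preimage hs hw.measurable]
  simp only [hw.map_smul]

theorem smulInvariantMeasure_compProd {P : Measure Y} [SFinite P] [SMulInvariantMeasure G Y P]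
    {η : Kernel Y Z} [IsSFiniteKernel η] (hη : ∀ (c : G) y, η (c • y) = (η y).map (c • ·)) :
    SMulInvariantMeasure G (Y × Z) (P ⊗ₘ η) := by
  refine ⟨fun c s hs => ?_⟩
  rw [compProd_apply hs, compProd_apply (measurable_const_smul c hs),
    ← (measurePreserving_smul c P).lintegral_comp (Kernel.measurable_kernel_prodMk_left hs)]
  refine lintegral_congr fun y => ?_
  rw [hη, map_apply (measurable_const_smul c) (measurable_prodMk_left hs)]
  rfl

end InvariantMeasures

section TwoEquivariantMaps

variable {G Z : Type*} [Group G] [MeasurableSpace G] [MeasurableMul₂ G] [MeasurableInv G]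
  [MeasurableSpace Z] [MulAction G Z] {Q : Measure Z} [SFinite Q] [SMulInvariantMeasure G Z Q]
  {π ρ : Z → G}

theorem measure_preimage_mul_measure {μ : Measure G} [SFinite μ] [μ.IsMulLeftInvariant]
    [μ.IsMulRightInvariant] (hπ : IsMeasurableEquivariant G π) (hρ : IsMeasurableEquivariant G ρ)
    {A B : Set G} (hA : MeasurableSet A) (hB : MeasurableSet B) :
    Q (π ⁻¹' B) * μ A = Q (ρ ⁻¹' A) * μ.inv B := by
  have hmul : MeasurePreserving (fun p : Z × G => (p.1, p.2 * ρ p.1)) (Q.prod μ) (Q.prod μ) :=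
    (MeasurePreserving.id Q).skew_product (g := fun q z => z * ρ q)
      (measurable_snd.mul (hρ.measurable.comp measurable_fst))
      (ae_of_all _ fun q => map_mul_right_eq_self μ (ρ q))
  have hinv : MeasurePreserving (fun p : Z × G => (p.1, p.2⁻¹ * π p.1)) (Q.prod μ)
      (Q.prod μ.inv) :=
    (MeasurePreserving.id Q).skew_product (g := fun q z => z⁻¹ * π q)
      (measurable_snd.inv.mul (hπ.measurable.comp measurable_fst))
      (ae_of_all _ fun q => by
        rw [← map_mul_right_eq_self μ.inv (π q), Measure.inv,
          map_map (measurable_mul_const _) measurable_inv]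
        rfl)
  have hS := (hπ.measurable hB).prod hA
  have hT := (hρ.measurable hA).prod hB
  rw [← prod_prod, ← prod_prod, ← hmul.measure_preimage hS.nullMeasurableSet,
    ← hinv.measure_preimage hT.nullMeasurableSet, prod_apply_symm (hmul.measurable hS),
    prod_apply_symm (hinv.measurable hT)]
  -- The two slices at `z` are translates of each other by `z`.
  refine lintegral_congr fun z => ?_
  refine Eq.trans (congrArg Q ?_) (measure_preimage_smul Q z _)
  ext q
  simp [hπ.map_smul, hρ.map_smul, and_comm]

end TwoEquivariantMaps

section Unimodular

variable {G Z : Type*} [Group G] [TopologicalSpace G] [IsTopologicalGroup G] [LocallyCompactSpace G]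
  [SecondCountableTopology G] [T2Space G] [MeasurableSpace G] [BorelSpace G]

theorem IsUnimodularGroup.isMulRightInvariant_haar (hG : IsUnimodularGroup G) :
    (haar : Measure G).IsMulRightInvariant := by
  refine ⟨fun g => ?_⟩
  rw [map_right_mul_eq_modularCharacterFun_smul haar g,
    show modularCharacterFun g = 1 from hG g, one_smul]

theorem IsUnimodularGroup.map_eq_map (hG : IsUnimodularGroup G) [MeasurableSpace Z]
    [MulAction G Z] {Q : Measure Z} [SFinite Q] [SMulInvariantMeasure G Z Q] {π ρ : Z → G}
    (hπ : IsMeasurableEquivariant G π) (hρ : IsMeasurableEquivariant G ρ) :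
    Q.map π = Q.map ρ := by
  have := hG.isMulRightInvariant_haar
  let K : TopologicalSpace.PositiveCompacts G := Classical.arbitrary _
  have hK0 : haar (K : Set G) ≠ 0 := (measure_pos_of_nonempty_interior _ K.interior_nonempty).ne'
  have hKtop : haar (K : Set G) ≠ ∞ := K.isCompact.measure_lt_top.ne
  have hKm : MeasurableSet (K : Set G)⁻¹ := K.isCompact.measurableSet.inv
  ext A hA
  rw [map_apply hπ.measurable hA, map_apply hρ.measurable hA]
  have h := measure_preimage_mul_measure (Q := Q) (μ := haar) hρ hπ hA hKm
  have h' := measure_preimage_mul_measure (Q := Q) (μ := haar) hρ hρ hA hKm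
  rw [inv_apply, inv_inv] at h h'
  exact (ENNReal.mul_left_inj hK0 hKtop).1 (h.symm.trans h')

end Unimodular

theorem ae_of_forall_isCompact {X Z : Type*} [TopologicalSpace X] [SigmaCompactSpace X]
    [MeasurableSpace Z] {Q : Measure Z} (φ : Z → X) {q : Z → Prop}
    (h : ∀ K, IsCompact K → ∀ᵐ z ∂Q.restrict (φ ⁻¹' K), q z) : ∀ᵐ z ∂Q, q z := by
  have hcover : ∀ᵐ z ∂Q.restrict (⋃ n, φ ⁻¹' compactCovering X n), q z :=
    (ae_restrict_iUnion_iff _ _).2 fun n => h _ (isCompact_compactCovering X n)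
  rwa [← Set.preimage_iUnion, iUnion_compactCovering, Set.preimage_univ, restrict_univ] at hcover

section Masses

variable {X Ω : Type*} [MeasurableSpace X] [MeasurableSpace Ω]

/-- The mass sent by each point `p.2` at the realisation `p.1` under a transport `w`, where
`w (ω, x, y)` is the mass sent from `x` to `y`. -/
noncomputable def massOut (κ : Kernel Ω X) (w : Ω × X × X → ℝ≥0∞) (p : Ω × X) : ℝ≥0∞ :=
  ∫⁻ y, w (p.1, p.2, y) ∂κ p.1

/-- The mass received by each point `p.2` at the realisation `p.1` under a transport `w`, where
`w (ω, x, y)` is the mass sent from `x` to `y`. -/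
noncomputable def massIn (κ : Kernel Ω X) (w : Ω × X × X → ℝ≥0∞) (p : Ω × X) : ℝ≥0∞ :=
  ∫⁻ x, w (p.1, x, p.2) ∂κ p.1

variable {κ : Kernel Ω X} [IsSFiniteKernel κ] {w : Ω × X × X → ℝ≥0∞} {P : Measure Ω} [SFinite P]

theorem setLIntegral_massOut_lt_top [TopologicalSpace X] [T2Space X] [OpensMeasurableSpace X]
    [IsLocallyFiniteMeasure (intensityMeasure P κ)] (hle : massOut κ w ≤ 1) {K : Set X}
    (hK : IsCompact K) : ∫⁻ p in Prod.snd ⁻¹' K, massOut κ w p ∂(P ⊗ₘ κ) < ∞ :=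
  calc ∫⁻ p in Prod.snd ⁻¹' K, massOut κ w p ∂(P ⊗ₘ κ)
      ≤ ∫⁻ _ in Prod.snd ⁻¹' K, 1 ∂(P ⊗ₘ κ) := lintegral_mono hle
    _ = (P ⊗ₘ κ).snd K := by rw [setLIntegral_one, snd_apply hK.measurableSet]
    _ = intensityMeasure P κ K := by rw [snd_compProd]; rfl
    _ < ∞ := hK.measure_lt_top

variable (hw : Measurable w)
include hw

theorem measurable_massOut : Measurable (massOut κ w) :=
  Measurable.lintegral_kernel_prod_right (κ := κ.comap Prod.fst measurable_fst)
    (f := fun (p : Ω × X) y => w (p.1, p.2, y))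
    (hw.comp (show Measurable fun q : (Ω × X) × X => (q.1.1, q.1.2, q.2) by fun_prop))

theorem measurable_massIn : Measurable (massIn κ w) :=
  measurable_massOut <|
    hw.comp (show Measurable fun p : Ω × X × X => (p.1, p.2.2, p.2.1) by fun_prop)

theorem lintegral_massOut : ∫⁻ p, massOut κ w p ∂(P ⊗ₘ κ) = ∫⁻ p, w p ∂(P ⊗ₘ (κ ×ₖ κ)) := by
  rw [lintegral_compProd (measurable_massOut hw), lintegral_compProd hw]
  exact lintegral_congr fun ω =>
    (Kernel.lintegral_prod κ κ ω (hw.comp measurable_prodMk_left)).symm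

theorem lintegral_massIn : ∫⁻ p, massIn κ w p ∂(P ⊗ₘ κ) = ∫⁻ p, w p ∂(P ⊗ₘ (κ ×ₖ κ)) := by
  rw [lintegral_compProd (measurable_massIn hw), lintegral_compProd hw]
  exact lintegral_congr fun ω =>
    (Kernel.lintegral_prod_symm κ κ ω (hw.comp measurable_prodMk_left)).symm

variable {B : Set X} (hB : MeasurableSet B)
include hB

theorem setLIntegral_massOut : ∫⁻ p in Prod.snd ⁻¹' B, massOut κ w p ∂(P ⊗ₘ κ) =
    ∫⁻ p in (fun p => p.2.1) ⁻¹' B, w p ∂(P ⊗ₘ (κ ×ₖ κ)) := by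
  have hB' : MeasurableSet ((fun p : Ω × X × X => p.2.1) ⁻¹' B) := hB.preimage (by fun_prop)
  rw [← lintegral_indicator (measurable_snd hB), ← lintegral_indicator hB',
    ← lintegral_massOut (hw.indicator hB')]
  refine lintegral_congr fun p => ?_
  by_cases hp : p.2 ∈ B <;> simp [massOut, Set.indicator, hp]

theorem setLIntegral_massIn : ∫⁻ p in Prod.snd ⁻¹' B, massIn κ w p ∂(P ⊗ₘ κ) =
    ∫⁻ p in (fun p => p.2.2) ⁻¹' B, w p ∂(P ⊗ₘ (κ ×ₖ κ)) := by
  have hB' : MeasurableSet ((fun p : Ω × X × X => p.2.2) ⁻¹' B) := hB.preimage (by fun_prop)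
  rw [← lintegral_indicator (measurable_snd hB), ← lintegral_indicator hB',
    ← lintegral_massIn (hw.indicator hB')]
  refine lintegral_congr fun p => ?_
  by_cases hp : p.2 ∈ B <;> simp [massIn, Set.indicator, hp]

end Masses

namespace IsFlowAdapted

variable {X Ω : Type*} [Group X] [MeasurableSpace X] [MulAction X Ω]

theorem map_smul [MeasurableMul X] {m : Ω → Measure X} (hm : IsFlowAdapted m) (x : X) (ω : Ω) :
    m (x • ω) = (m ω).map (x • ·) := by
  ext B hB
  rw [hm x ω B hB, map_apply (measurable_const_smul x) hB, ← Set.preimage_smul]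

variable [MeasurableSpace Ω] {κ : Kernel Ω X} [IsSFiniteKernel κ] (hκ : IsFlowAdapted κ)
include hκ

theorem isMeasurableInvariant_apply [MeasurableMul X] {R : Ω × X × X → Prop}
    (hR : IsMeasurableInvariant X R) :
    IsMeasurableInvariant X fun p : Ω × X => κ p.1 {z | R (p.1, p.2, z)} where
  measurable := Kernel.measurable_kernel_prodMk_left (κ := κ.comap Prod.fst measurable_fst)
    (t := {q : (Ω × X) × X | R (q.1.1, q.1.2, q.2)})
    (hR.measurable.setOf.preimage (by fun_prop))
  map_smul c p := by
    have hmeas : MeasurableSet {z | R (c • p.1, c • p.2, z)} :=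
      hR.measurable.setOf.preimage (by fun_prop)
    dsimp only [Prod.smul_fst, Prod.smul_snd]
    rw [hκ.map_smul, map_apply (measurable_const_smul c) hmeas]
    exact congrArg _ (Set.ext fun z => (hR.map_smul c (p.1, p.2, z)).to_iff)

variable [TopologicalSpace X] [IsTopologicalGroup X] [LocallyCompactSpace X]
  [SecondCountableTopology X] [T2Space X] [BorelSpace X] [MeasurableConstSMul X Ω]
  {P : Measure Ω} [SFinite P] [SMulInvariantMeasure X Ω P] (hX : IsUnimodularGroup X)
include hX

theorem setLIntegral_massOut_eq_massIn {w : Ω × X × X → ℝ≥0∞} (hw : IsMeasurableInvariant X w)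
    {B : Set X} (hB : MeasurableSet B) :
    ∫⁻ p in Prod.snd ⁻¹' B, massOut κ w p ∂(P ⊗ₘ κ) =
      ∫⁻ p in Prod.snd ⁻¹' B, massIn κ w p ∂(P ⊗ₘ κ) := by
  have hpairs (x : X) (ω : Ω) : (κ ×ₖ κ) (x • ω) = ((κ ×ₖ κ) ω).map (x • ·) := by
    rw [Kernel.prod_apply, Kernel.prod_apply, hκ.map_smul,
      map_prod_map _ _ (measurable_const_smul x) (measurable_const_smul x)]
    rfl
  have := smulInvariantMeasure_compProd (P := P) hpairs
  have := smulInvariantMeasure_withDensity (Q := P ⊗ₘ (κ ×ₖ κ)) hw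
  have hmap := congrArg (fun μ : Measure X => μ B) <|
    hX.map_eq_map (Q := (P ⊗ₘ (κ ×ₖ κ)).withDensity w)
      (π := fun p => p.2.1) (ρ := fun p => p.2.2) ⟨by fun_prop, fun _ _ => rfl⟩
      ⟨by fun_prop, fun _ _ => rfl⟩
  rw [setLIntegral_massOut hw.measurable hB, setLIntegral_massIn hw.measurable hB]
  rwa [map_apply (by fun_prop) hB, map_apply (by fun_prop) hB,
    withDensity_apply _ (hB.preimage (by fun_prop)),
    withDensity_apply _ (hB.preimage (by fun_prop))] at hmap

variable [IsLocallyFiniteMeasure (intensityMeasure P κ)]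

theorem ae_massIn_lt_top {w : Ω × X × X → ℝ≥0∞} (hw : IsMeasurableInvariant X w)
    (hle : massOut κ w ≤ 1) : ∀ᵐ ω ∂P, ∀ᵐ y ∂κ ω, massIn κ w (ω, y) < ∞ := by
  suffices h : ∀ᵐ p ∂(P ⊗ₘ κ), massIn κ w p < ∞ from ae_ae_of_ae_compProd h
  refine ae_of_forall_isCompact Prod.snd fun K hK => ?_
  refine ae_lt_top (measurable_massIn hw.measurable) ?_
  rw [← hκ.setLIntegral_massOut_eq_massIn hX hw hK.measurableSet]
  exact (setLIntegral_massOut_lt_top hle hK).ne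

theorem ae_massOut_eq_massIn {w : Ω × X × X → ℝ≥0∞} (hw : IsMeasurableInvariant X w)
    (hle : massOut κ w ≤ 1)
    (hout : ∀ᵐ ω ∂P, ∀ᵐ x ∂κ ω, massOut κ w (ω, x) ≤ massIn κ w (ω, x)) :
    ∀ᵐ ω ∂P, ∀ᵐ x ∂κ ω, massOut κ w (ω, x) = massIn κ w (ω, x) := by
  have hae : massOut κ w ≤ᵐ[P ⊗ₘ κ] massIn κ w := ae_compProd_of_ae_ae
    (measurableSet_le (measurable_massOut hw.measurable) (measurable_massIn hw.measurable)) hout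
  suffices h : ∀ᵐ p ∂(P ⊗ₘ κ), massOut κ w p = massIn κ w p from ae_ae_of_ae_compProd h
  refine ae_of_forall_isCompact Prod.snd fun K hK => ?_
  exact ae_eq_of_ae_le_of_lintegral_le (ae_restrict_of_ae hae)
    (setLIntegral_massOut_lt_top hle hK).ne (measurable_massIn hw.measurable).aemeasurable
    (hκ.setLIntegral_massOut_eq_massIn hX hw hK.measurableSet).ge

theorem ae_measure_eq_of_le {R : Ω × X × X → Prop} (hR : IsMeasurableInvariant X R)
    (hle_one : ∀ ω x, κ ω {z | R (ω, x, z)} ≤ 1)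
    (hle : ∀ᵐ ω ∂P, ∀ᵐ x ∂κ ω, κ ω {z | R (ω, x, z)} ≤ κ ω {z | R (ω, z, x)}) :
    ∀ᵐ ω ∂P, ∀ᵐ x ∂κ ω, κ ω {z | R (ω, x, z)} = κ ω {z | R (ω, z, x)} := by
  let w : Ω × X × X → ℝ≥0∞ := {p | R p}.indicator 1
  have hw : IsMeasurableInvariant X w :=
    IsMeasurableInvariant.indicator ⟨measurable_const, fun _ _ => rfl⟩ hR
  have hout (ω : Ω) (x : X) : massOut κ w (ω, x) = κ ω {z | R (ω, x, z)} :=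
    lintegral_indicator_one (hR.measurable.setOf.preimage (by fun_prop))
  have hin (ω : Ω) (x : X) : massIn κ w (ω, x) = κ ω {z | R (ω, z, x)} :=
    lintegral_indicator_one (hR.measurable.setOf.preimage (by fun_prop))
  simp only [← hout, ← hin] at hle_one hle ⊢
  exact hκ.ae_massOut_eq_massIn hX hw (fun p => hle_one p.1 p.2) hle

theorem ae_measure_lt_top_of_bounded {R : Ω × X × X → Prop} (hR : IsMeasurableInvariant X R) :
    ∀ᵐ ω ∂P, ∀ᵐ y ∂κ ω, ∀ c ≠ ∞, (∀ x, R (ω, x, y) → κ ω {z | R (ω, x, z)} ≤ c) →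
      κ ω {x | R (ω, x, y)} < ∞ := by
  -- Each point spreads a unit mass uniformly over the points it is related to.
  let deg : Ω × X → ℝ≥0∞ := fun p => κ p.1 {z | R (p.1, p.2, z)}
  let w : Ω × X × X → ℝ≥0∞ := {p | R p}.indicator fun p => (deg (p.1, p.2.1))⁻¹
  have hfst : IsMeasurableEquivariant X fun p : Ω × X × X => (p.1, p.2.1) :=
    ⟨by fun_prop, fun _ _ => rfl⟩
  have hw : IsMeasurableInvariant X w :=
    (((hκ.isMeasurableInvariant_apply hR).comp_equivariant hfst).measurable_comp
      measurable_inv).indicator hR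
  have hsec (ω : Ω) (x : X) : MeasurableSet {z | R (ω, x, z)} :=
    hR.measurable.setOf.preimage (by fun_prop)
  have hsec' (ω : Ω) (y : X) : MeasurableSet {x | R (ω, x, y)} :=
    hR.measurable.setOf.preimage (by fun_prop)
  have hout : massOut κ w ≤ 1 := fun p => by
    calc massOut κ w p = ∫⁻ _ in {z | R (p.1, p.2, z)}, (deg p)⁻¹ ∂κ p.1 :=
          lintegral_indicator (hsec p.1 p.2) _
      _ = (deg p)⁻¹ * deg p := setLIntegral_const _ _
      _ ≤ 1 := by rw [mul_comm]; exact ENNReal.mul_inv_le_one _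
  filter_upwards [hκ.ae_massIn_lt_top hX hw hout] with ω hω
  filter_upwards [hω] with y hy c hc hbound
  have hin : c⁻¹ * κ ω {x | R (ω, x, y)} ≤ massIn κ w (ω, y) := by
    calc c⁻¹ * κ ω {x | R (ω, x, y)} = ∫⁻ _ in {x | R (ω, x, y)}, c⁻¹ ∂κ ω :=
          (setLIntegral_const _ _).symm
      _ ≤ ∫⁻ x in {x | R (ω, x, y)}, (deg (ω, x))⁻¹ ∂κ ω :=
          setLIntegral_mono' (hsec' ω y) fun x hx => ENNReal.inv_le_inv.2 (hbound x hx)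
      _ = massIn κ w (ω, y) := (lintegral_indicator (hsec' ω y) _).symm
  exact ENNReal.lt_top_of_mul_ne_top_right (hin.trans_lt hy).ne (ENNReal.inv_ne_zero.2 hc)

end IsFlowAdapted

end MassTransport

section PointShifts

open Function ProbabilityTheory

section Transfer

variable {X Ω : Type*} [TopologicalSpace X] [SecondCountableTopology X] [T3Space X]
  [MeasurableSpace X] [BorelSpace X] [MeasurableSpace Ω] {H : Ω → X → X}
  {m : Ω → Measure X} (hm : IsSimplePointProcess m) {ω : Ω}
  {hf : Set.MapsTo (H ω) (pointsOf (m ω)) (pointsOf (m ω))} {x : pointsOf (m ω)}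
include hm

theorem finite_setOf_sameFoil_restrict_iff :
    {z | SameFoil (hf.restrict (H ω) _ _) x z}.Finite ↔ m ω {z | SameFoil (H ω) x z} < ∞ := by
  simp only [sameFoil_restrict_iff hf, hm.apply_lt_top_iff]

theorem mem_primevalPts_restrict_iff :
    x ∈ primevalPts (hf.restrict (H ω) _ _) ↔ ∀ n : ℕ, m ω {z | (H ω)^[n] z = x} ≠ 0 :=
  forall_congr' fun n => (exists_congr fun _ => iterate_restrict_eq_iff (k := 0) hf).trans
    (hm.apply_ne_zero_iff (p := fun z => (H ω)^[n] z = x) ω).symm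

theorem mem_lastFiniteFoilPts_restrict_iff :
    x ∈ lastFiniteFoilPts (hf.restrict (H ω) _ _) ↔ m ω {z | SameFoil (H ω) x z} < ∞ ∧
      ¬ m ω {z | SameFoil (H ω) (H ω x) z} < ∞ :=
  and_congr (finite_setOf_sameFoil_restrict_iff hm)
    (not_congr (finite_setOf_sameFoil_restrict_iff hm))

theorem mem_youngestFiniteFoilPts_restrict_iff :
    x ∈ youngestFiniteFoilPts (hf.restrict (H ω) _ _) ↔ m ω {z | SameFoil (H ω) x z} < ∞ ∧
      ¬ m ω {z | SameFoil (H ω) x (H ω z)} ≠ 0 :=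
  and_congr (finite_setOf_sameFoil_restrict_iff hm) <| by
    rw [hm.apply_ne_zero_iff, not_exists]
    exact forall_congr' fun _ => not_congr (sameFoil_restrict_iff hf)

end Transfer

variable {X Ω : Type*} [Group X] [MeasurableSpace X] [MeasurableSpace Ω] [MulAction X Ω]
  {P : Measure Ω} {H : Ω → X → X}

namespace IsFlowAdaptedPointShift

variable {m : Ω → Measure X} (hH : IsFlowAdaptedPointShift P m H)
include hH

theorem isMeasurableEquivariant_iterate (n : ℕ) :
    IsMeasurableEquivariant X fun p : Ω × X => (H p.1)^[n] p.2 := by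
  induction n with
  | zero => exact ⟨measurable_snd, fun _ _ => rfl⟩
  | succ n ih =>
    simp only [iterate_succ_apply']
    exact ⟨hH.measurable.comp (measurable_fst.prodMk ih.measurable), fun c p => by
      rw [ih.map_smul]; exact hH.flowAdapted p.1 _ c⟩

theorem isMeasurableEquivariant_iterate_fst (n : ℕ) :
    IsMeasurableEquivariant X fun p : Ω × X × X => (H p.1)^[n] p.2.1 :=
  (hH.isMeasurableEquivariant_iterate n).comp (ψ := fun p : Ω × X × X => (p.1, p.2.1))
    ⟨by fun_prop, fun _ _ => rfl⟩

theorem isMeasurableEquivariant_iterate_snd (n : ℕ) :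
    IsMeasurableEquivariant X fun p : Ω × X × X => (H p.1)^[n] p.2.2 :=
  (hH.isMeasurableEquivariant_iterate n).comp (ψ := fun p : Ω × X × X => (p.1, p.2.2))
    ⟨by fun_prop, fun _ _ => rfl⟩

variable [TopologicalSpace X] [BorelSpace X] [SecondCountableTopology X] [T2Space X]

theorem isMeasurableInvariant_iterate_eq (n : ℕ) :
    IsMeasurableInvariant X fun p : Ω × X × X => (H p.1)^[n] p.2.1 = p.2.2 :=
  (hH.isMeasurableEquivariant_iterate_fst n).eq (hH.isMeasurableEquivariant_iterate_snd 0)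

theorem isMeasurableInvariant_sameComponent :
    IsMeasurableInvariant X fun p : Ω × X × X => SameComponent (H p.1) p.2.1 p.2.2 :=
  .exists_nat fun n => .exists_nat fun k =>
    (hH.isMeasurableEquivariant_iterate_fst n).eq (hH.isMeasurableEquivariant_iterate_snd k)

theorem isMeasurableInvariant_sameFoil :
    IsMeasurableInvariant X fun p : Ω × X × X => SameFoil (H p.1) p.2.1 p.2.2 :=
  .exists_nat fun n =>
    (hH.isMeasurableEquivariant_iterate_fst n).eq (hH.isMeasurableEquivariant_iterate_snd n)

theorem isMeasurableInvariant_mem_periodicPts :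
    IsMeasurableInvariant X fun p : Ω × X => p.2 ∈ periodicPts (H p.1) :=
  .exists_nat fun n => .and ⟨measurable_const, fun _ _ => rfl⟩ <|
    (hH.isMeasurableEquivariant_iterate n).eq (hH.isMeasurableEquivariant_iterate 0)

variable [IsTopologicalGroup X] {κ : Kernel Ω X} [IsSFiniteKernel κ] (hκ : IsFlowAdapted κ)
include hκ

theorem isMeasurableInvariant_primeval : IsMeasurableInvariant X fun p : Ω × X =>
    ∀ n : ℕ, κ p.1 {z | (H p.1)^[n] z = p.2} ≠ 0 :=
  .forall_nat fun n => (hκ.isMeasurableInvariant_apply <|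
    (hH.isMeasurableEquivariant_iterate_snd n).eq (hH.isMeasurableEquivariant_iterate_fst 0)
    ).measurable_comp (h := (· ≠ 0)) (measurableSet_singleton 0).compl.mem

theorem isMeasurableInvariant_finite_foil : IsMeasurableInvariant X fun p : Ω × X =>
    κ p.1 {z | SameFoil (H p.1) p.2 z} < ∞ :=
  (hκ.isMeasurableInvariant_apply hH.isMeasurableInvariant_sameFoil).measurable_comp
    (h := (· < ∞)) measurableSet_Iio.mem

theorem isMeasurableInvariant_lastFiniteFoil : IsMeasurableInvariant X fun p : Ω × X =>
    κ p.1 {z | SameFoil (H p.1) p.2 z} < ∞ ∧ ¬ κ p.1 {z | SameFoil (H p.1) (H p.1 p.2) z} < ∞ :=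
  (hH.isMeasurableInvariant_finite_foil hκ).and <|
    ((hH.isMeasurableInvariant_finite_foil hκ).comp_equivariant
      (φ := fun p : Ω × X => (p.1, H p.1 p.2))
        ⟨measurable_fst.prodMk hH.measurable,
          fun c p => Prod.ext rfl (hH.flowAdapted p.1 p.2 c)⟩).not

theorem isMeasurableInvariant_youngestFiniteFoil : IsMeasurableInvariant X fun p : Ω × X =>
    κ p.1 {z | SameFoil (H p.1) p.2 z} < ∞ ∧ ¬ κ p.1 {z | SameFoil (H p.1) p.2 (H p.1 z)} ≠ 0 :=
  (hH.isMeasurableInvariant_finite_foil hκ).and <|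
    ((hκ.isMeasurableInvariant_apply <| .exists_nat fun n =>
      (hH.isMeasurableEquivariant_iterate_fst n).eq
        (hH.isMeasurableEquivariant_iterate_snd (n + 1))).measurable_comp
      (h := (· ≠ 0)) (measurableSet_singleton 0).compl.mem).not

end IsFlowAdaptedPointShift

section AlmostSure

variable [TopologicalSpace X] [IsTopologicalGroup X] [LocallyCompactSpace X]
  [SecondCountableTopology X] [T2Space X] [BorelSpace X] [MeasurableConstSMul X Ω]
  [SFinite P] [SMulInvariantMeasure X Ω P] {κ : Kernel Ω X} [IsSFiniteKernel κ]
  [IsLocallyFiniteMeasure (intensityMeasure P κ)] (hX : IsUnimodularGroup X)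
  (hκ : IsFlowAdapted κ) (hm : IsSimplePointProcess κ)
include hX hκ hm

theorem ae_noFiniteSelection {r : Ω × X × X → Prop} {D : Ω × X → Prop}
    (hr : IsMeasurableInvariant X r) (hequiv : ∀ ω, Equivalence fun x y => r (ω, x, y))
    (hD : IsMeasurableInvariant X D) :
    ∀ᵐ ω ∂P, NoFiniteSelection (fun x y : pointsOf (κ ω) => r (ω, x, y)) {x | D (ω, x)} := by
  have hR := hr.and (hD.comp_equivariant (φ := fun p : Ω × X × X => (p.1, p.2.2))
    ⟨by fun_prop, fun _ _ => rfl⟩)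
  filter_upwards [hκ.ae_measure_lt_top_of_bounded hX (P := P) hR] with ω hω y hy hfin
  have hbound := (hm.ae_iff ω).1 hω y (κ ω {z | r (ω, y, z) ∧ D (ω, z)})
    ((hm.apply_lt_top_iff ω).2 <| by rwa [Set.ofPred_and]).ne fun x hx =>
      measure_mono fun z hz => ⟨(hequiv ω).trans ((hequiv ω).symm hx.1) hz.1, hz.2⟩
  exact ((hm.apply_lt_top_iff ω).1 hbound).subset fun x hx => ⟨(hequiv ω).symm hx, hy⟩

variable (hH : IsFlowAdaptedPointShift P κ H)
include hH

theorem ae_finite_fiber : ∀ᵐ ω ∂P, ∀ (hf : Set.MapsTo (H ω) (pointsOf (κ ω)) (pointsOf (κ ω)))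
    (y : pointsOf (κ ω)), {x | hf.restrict (H ω) _ _ x = y}.Finite := by
  filter_upwards [hκ.ae_measure_lt_top_of_bounded hX (P := P)
    (hH.isMeasurableInvariant_iterate_eq 1)] with ω hω hf y
  have hfin := (hm.apply_lt_top_iff ω).1 <| (hm.ae_iff ω).1 hω y 1 ENNReal.one_ne_top fun x hx =>
    (measure_mono fun z hz => hz.symm.trans hx).trans (hm.simple ω y y.2).le
  exact hfin.subset fun x hx => congrArg Subtype.val hx

theorem ae_injOn_primevalPts : ∀ᵐ ω ∂P, ∀ hf : Set.MapsTo (H ω) (pointsOf (κ ω)) (pointsOf (κ ω)),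
    Set.InjOn (hf.restrict (H ω) _ _) (primevalPts (hf.restrict (H ω) _ _)) := by
  -- Each primeval point sends a unit mass to its image, and every primeval point is such an image.
  let R : Ω × X × X → Prop := fun p =>
    (∀ n : ℕ, κ p.1 {z | (H p.1)^[n] z = p.2.1} ≠ 0) ∧ H p.1 p.2.1 = p.2.2
  have hR : IsMeasurableInvariant X R :=
    ((hH.isMeasurableInvariant_primeval hκ).comp_equivariant
      (φ := fun p : Ω × X × X => (p.1, p.2.1)) ⟨by fun_prop, fun _ _ => rfl⟩).and
      (hH.isMeasurableInvariant_iterate_eq 1)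
  have hR_iff (ω : Ω) (hf : Set.MapsTo (H ω) (pointsOf (κ ω)) (pointsOf (κ ω)))
      (x y : pointsOf (κ ω)) : R (ω, x, y) ↔ x ∈ primevalPts (hf.restrict (H ω) _ _) ∧
        hf.restrict (H ω) _ _ x = y :=
    and_congr (mem_primevalPts_restrict_iff hm).symm
      (Subtype.coe_inj (a := hf.restrict (H ω) _ _ x) (b := y))
  have hout (ω : Ω) (x : X) : κ ω {z | R (ω, x, z)} ≤ 1 :=
    (hm.apply_le_one_iff ω).2 fun y z hy hz => Subtype.ext (hy.2.symm.trans hz.2)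
  have hle : ∀ᵐ ω ∂P, ∀ᵐ x ∂κ ω, κ ω {z | R (ω, x, z)} ≤ κ ω {z | R (ω, z, x)} := by
    filter_upwards [hH.mapsTo, ae_finite_fiber hX hκ hm hH] with ω (hf : Set.MapsTo _ _ _) hfib
    refine (hm.ae_iff ω).2 fun x => ?_
    by_cases hx : x ∈ primevalPts (hf.restrict (H ω) _ _)
    · obtain ⟨z, hz, hzx⟩ := surjOn_primevalPts (g := hf.restrict (H ω) _ _) (hfib hf) hx
      exact (hout ω x).trans ((hm.one_le_apply_iff ω).2 ⟨z, (hR_iff ω hf z x).2 ⟨hz, hzx⟩⟩)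
    · refine le_of_eq_of_le (not_ne_iff.1 fun h => ?_) zero_le
      obtain ⟨z, hz⟩ := (hm.apply_ne_zero_iff ω).1 h
      exact hx ((hR_iff ω hf x z).1 hz).1
  filter_upwards [hκ.ae_measure_eq_of_le hX hR hout hle] with ω hω hf x hx y hy hxy
  have hin := ((hm.ae_iff ω).1 hω (hf.restrict (H ω) _ _ y)).symm.trans_le (hout ω _)
  exact (hm.apply_le_one_iff ω).1 hin x y ((hR_iff ω hf _ _).2 ⟨hx, hxy⟩)
    ((hR_iff ω hf _ _).2 ⟨hy, rfl⟩)

theorem ae_isMassTransportRegular : ∀ᵐ ω ∂P,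
    ∃ hf : Set.MapsTo (H ω) (pointsOf (κ ω)) (pointsOf (κ ω)),
      IsMassTransportRegular (hf.restrict (H ω) _ _) := by
  have hcomp := hH.isMeasurableInvariant_sameComponent
  have hcomp_equiv (ω : Ω) := equivalence_sameComponent (H ω)
  filter_upwards [hH.mapsTo, ae_finite_fiber hX hκ hm hH, ae_injOn_primevalPts hX hκ hm hH,
    ae_noFiniteSelection hX hκ hm (P := P) hcomp hcomp_equiv
      hH.isMeasurableInvariant_mem_periodicPts,
    ae_noFiniteSelection hX hκ hm (P := P) hcomp hcomp_equiv
      (hH.isMeasurableInvariant_lastFiniteFoil hκ),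
    ae_noFiniteSelection hX hκ hm (P := P) hcomp hcomp_equiv
      (hH.isMeasurableInvariant_youngestFiniteFoil hκ),
    ae_noFiniteSelection hX hκ hm (P := P) hH.isMeasurableInvariant_sameFoil
      (fun ω => equivalence_sameFoil (H ω)) (hH.isMeasurableInvariant_primeval hκ)]
    with ω hf hfib hinj hperiodic hlast hyoungest hprimeval
  exact ⟨hf, {
    finite_fiber := hfib hf
    injOn_primevalPts := hinj hf
    periodicPts := hperiodic.congr (fun _ _ => sameComponent_restrict_iff hf)
      fun _ => mem_periodicPts_restrict_iff hf
    lastFiniteFoilPts := hlast.congr (fun _ _ => sameComponent_restrict_iff hf)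
      fun _ => mem_lastFiniteFoilPts_restrict_iff hm
    youngestFiniteFoilPts := hyoungest.congr (fun _ _ => sameComponent_restrict_iff hf)
      fun _ => mem_youngestFiniteFoilPts_restrict_iff hm
    primevalPts := hprimeval.congr (fun _ _ => sameFoil_restrict_iff hf)
      fun _ => mem_primevalPts_restrict_iff hm }⟩

end AlmostSure

end PointShifts

theorem mainTheorem1_general {X Ω : Type*}
    [Group X] [TopologicalSpace X] [IsTopologicalGroup X] [LocallyCompactSpace X]
    [SecondCountableTopology X] [T2Space X] [MeasurableSpace X] [BorelSpace X]
    (hX : IsUnimodularGroup X)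
    [MeasurableSpace Ω] (P : Measure Ω) [SFinite P]
    [MulAction X Ω] [MeasurableConstSMul X Ω] [SMulInvariantMeasure X Ω P]
    (m : Ω → Measure X) (hm : IsSimplePointProcess m) (hmθ : IsFlowAdapted m)
    (hmI : IsLocallyFiniteMeasure (intensityMeasure P m))
    (H : Ω → X → X) (hH : IsFlowAdaptedPointShift P m H) :
    ∀ᵐ ω ∂P, ∀ C : FunctionalComponent (pointsOf (m ω)) (H ω),
      (IsClassFF (pointsOf (m ω)) (H ω) C ∨ IsClassIF (pointsOf (m ω)) (H ω) C ∨
        IsClassII (pointsOf (m ω)) (H ω) C) ∧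
      (IsClassFF (pointsOf (m ω)) (H ω) C → StructureFF (pointsOf (m ω)) (H ω) C) ∧
      (IsClassIF (pointsOf (m ω)) (H ω) C → StructureIF (pointsOf (m ω)) (H ω) C) ∧
      (IsClassII (pointsOf (m ω)) (H ω) C → StructureII (pointsOf (m ω)) (H ω) C) := by
  let κ : ProbabilityTheory.Kernel Ω X := ⟨m, hm.measurable⟩
  have : ProbabilityTheory.IsSFiniteKernel κ :=
    isSFiniteKernel_of_isLocallyFiniteMeasure hm.locallyFinite
  filter_upwards [ae_isMassTransportRegular (κ := κ) hX hmθ hm hH] with ω ⟨hf, hg⟩ C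
  exact ⟨hg.isClass, structureFF_of_isClassFF hf, hg.structureIF, hg.structureII⟩

theorem mainTheorem1 {X Ω : Type*}
    [Group X] [TopologicalSpace X] [IsTopologicalGroup X] [LocallyCompactSpace X]
    [SecondCountableTopology X] [T2Space X] [MeasurableSpace X] [BorelSpace X]
    (hX : IsUnimodularGroup X)
    [MeasurableSpace Ω] (P : Measure Ω) [IsProbabilityMeasure P]
    [MulAction X Ω] [MeasurableSMul₂ X Ω] [SMulInvariantMeasure X Ω P]
    (m : Ω → Measure X) (hm : IsSimplePointProcess m) (hmθ : IsFlowAdapted m)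
    (hmI : HasFiniteNonzeroIntensity P m)
    (H : Ω → X → X) (hH : IsFlowAdaptedPointShift P m H) :
    ∀ᵐ ω ∂P, ∀ C : FunctionalComponent (pointsOf (m ω)) (H ω),
      (IsClassFF (pointsOf (m ω)) (H ω) C ∨ IsClassIF (pointsOf (m ω)) (H ω) C ∨
        IsClassII (pointsOf (m ω)) (H ω) C) ∧
      (IsClassFF (pointsOf (m ω)) (H ω) C → StructureFF (pointsOf (m ω)) (H ω) C) ∧
      (IsClassIF (pointsOf (m ω)) (H ω) C → StructureIF (pointsOf (m ω)) (H ω) C) ∧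
      (IsClassII (pointsOf (m ω)) (H ω) C → StructureII (pointsOf (m ω)) (H ω) C) := by
  exact mainTheorem1_general hX P m hm hmθ hmI.1 H hH
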